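/- **Problem.** Let $f:\mathbb R^n\to\mathbb R$ be twice continuously differentiable and bounded below, $\lambda>0$, $l,u\in\mathbb R^n_+$, $\Omega=\{x:-l\le x\le u\}$, and consider $\min_{x\in\Omega}\phi(x):=f(x)+\lambda\|x\|_0$, where $\|x\|_0$ is the number of nonzero entries of $x$. Assume $\nabla f(0)\ne 0$. $\|\cdot\|$ is the Euclidean (spectral) norm and $\Pi_\Omega$ the projection onto $\Omega$. For $\tau>0$ and $z=x-\tau\nabla f(x)$ put $$\Theta(x)=\{i:-l_i<z_i<u_i,\ |z_i|\ge\sqrt{2\tau\lambda}\},\quad \Gamma(x)=\{i:z_i\ge u_i\text{ or }z_i\le -l_i\},\quad \mathcal I(x)=\Theta(x)\cup\Gamma(x),$$ and let $\overline{\mathcal I}(x)$ be the complement of $\mathcal I(x)$. **Algorithm BNL0R.** Parameters: $\tau,\delta>0$, $\sigma\in(0,\tfrac12)$, $\beta\in(0,1)$, with $\lambda<\min\{\tfrac\tau2|\nabla_if(0)|^2:\nabla_if(0)\neq0\}$; start: $x^0\in\Omega$, $\mathcal I_{-1}=\emptyset$. At step $k$ write $\Theta_k,\Gamma_k,\mathcal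 I_k$ for the sets at $x^k$ and $g^k=\nabla f(x^k)$. A *Newton direction* at $x^k$ is a solution $d$ of $$[\nabla^2f(x^k)d]_{\Theta_k}=-g^k_{\Theta_k},\qquad d_{\Gamma_k}=[\Pi_\Omega(x^k-\tau g^k)-x^k]_{\Gamma_k},\qquad d_{\overline{\mathcal I}_k}=-x^k_{\overline{\mathcal I}_k}.$$ It is *accepted* if $\langle g^k_{\mathcal I_k},d_{\mathcal I_k}\rangle\le-\delta\|d\|^2+\|x^k_{\overline{\mathcal I}_k}\|^2/(4\tau)$, $|\mathcal I_k|\le\|x^k\|_0$, $x^k+d\in\Omega$, and ($\Theta_k\setminus\mathcal I_{k-1}\neq\emptyset$ or $\mathcal I_k=\mathcal I_{k-1}$). If it is accepted, set $d^k=d$ and $x^{k+1}=\tilde x^k(\beta^{m})$, where $\tilde x^k(\alpha)$ equals $x^k+\alpha d^k$ on $\Theta_k$, $x^k+d^k$ on $\Gamma_k$ and $0$ on $\overline{\mathcal I}_k$, and $m\ge0$ is the smallest integer with $f(\tilde x^k(\beta^m))\le f(x^k)+\sigma\beta^m\langle g^k,d^k\rangle$. If the Newton system is unsolvable or the computed solution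 is not accepted, set $d^k_{\mathcal I_k}=[\Pi_\Omega(x^k-\tau g^k)-x^k]_{\mathcal I_k}$, $d^k_{\overline{\mathcal I}_k}=-x^k_{\overline{\mathcal I}_k}$ and $x^{k+1}=x^k+d^k$. **Constants.** For $L>0$ let $a=\min_i\min(l_i^2,u_i^2)$ and $$\overline\alpha=\min\Big\{\tfrac{1-2\sigma}{L/\delta-\sigma},\tfrac{2(1-\sigma)\delta}{L},1\Big\},\quad \overline\tau=\min\Big\{\tfrac{2\overline\alpha\delta\beta}{nL^2},\tfrac{\overline\alpha\beta}{n},\tfrac1{4L},\tfrac{2(1-\sigma)}L,\tfrac a{2\lambda},\tfrac a{2\max_i|\nabla_if(0)|}\Big\}.$$ **Theorem (global and quadratic convergence).** Let $f$ be strongly smooth with constant $L>0$, i.e. $f(z)\le f(x)+\langle\nabla f(x),z-x\rangle+\frac L2\|z-x\|^2$ for all $x,z\in\mathbb R^n$, and let $\|\nabla^2f(x)\|\le L$ for $x\in\Omega$. Let $\{x^k\}$ be an infinite sequence generated by BNL0R and let $x^*$ be one of its accumulation points. Let $f$ be strongly convex with constant $\ell_*>0$ on a neighbourhood of $x^*$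 (i.e. $f(z)\ge f(x)+\langle\nabla f(x),z-x\rangle+\frac{\ell_*}2\|z-x\|^2$ for $x,z$ near $x^*$), and let $\tau\in(0,\overline\tau)$, $\delta\in(0,\min\{1,\ell_*\})$. Assume that strict complementarity and Abadie's constraint qualification hold at $x^*$ for the problem of minimizing $f(x)$ subject to $-l_i\le x_i\le u_i$ ($i\in\mathcal I_\infty$) and $x_i=0$ ($i\notin\mathcal I_\infty$), whenever $\mathcal I_\infty$ is an index set with $\mathcal I_k=\mathcal I_\infty$ for all large $k$. (Strict complementarity: in every system of Karush–Kuhn–Tucker multipliers at $x^*$, each active bound has a positive multiplier. Abadie: the tangent cone of the feasible set at $x^*$ equals the linearized cone.) Then: (i) the whole sequence converges to $x^*$, and $x^*$ is a strict local minimizer of $\phi$ on $\Omega$; (ii) for all sufficiently large $k$ the Newton direction is accepted, i.e. $x^{k+1}$ is obtained by the Newton step; (iii) if $\nabla^2f$ is Lipschitz continuous with constant $M_*\ge0$ on a neighbourhood of $x^*$, then for all sufficiently large $k$ $$\|x^{k+1}-x^*\|\le\frac{M_*}{2\tilde\ell_*}\|x^k-x^*\|^2,\qquad \tilde\ell_*=\min(1,\ell_*).$$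 -/

import Mathlib

open Filter Topology Set

noncomputable section

namespace BNL0R

/-- The Euclidean space `ℝⁿ` with the `ℓ₂` norm. -/
abbrev Vec (n : ℕ) := EuclideanSpace ℝ (Fin n)

/-- Data of the box-constrained `ℓ₀`-regularized problem
`min f x + lam * ‖x‖₀` subject to `-l ≤ x ≤ u`. -/
structure Problem (n : ℕ) where
  f : Vec n → ℝ
  l : Vec n
  u : Vec n
  lam : ℝ

/-- Parameters of the algorithm. -/
structure Params where
  tau : ℝ
  delta : ℝ
  sigma : ℝ
  beta : ℝ

/-- The Hessian `∇² f x`, as a continuous linear operator on `ℝⁿ`; its operator norm is the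
spectral norm of the Hessian matrix. -/
def hess {n : ℕ} (f : Vec n → ℝ) (x : Vec n) : Vec n →L[ℝ] Vec n :=
  fderiv ℝ (gradient f) x

/-- The support of `x`. -/
def supp {n : ℕ} (x : Vec n) : Finset (Fin n) :=
  Finset.univ.filter fun i => x i ≠ 0

/-- `‖x‖₀`, the number of nonzero entries. -/
def l0norm {n : ℕ} (x : Vec n) : ℕ := (supp x).card

/-- `f` is strongly smooth with constant `L`. -/
def StronglySmooth {n : ℕ} (f : Vec n → ℝ) (L : ℝ) : Prop :=
  ∀ x z : Vec n, f z ≤ f x + inner ℝ (gradient f x) (z - x) + L / 2 * ‖z - x‖ ^ 2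

/-- `f` is strongly convex with constant `c` on a neighbourhood of `a`. -/
def LocallyStronglyConvex {n : ℕ} (f : Vec n → ℝ) (c : ℝ) (a : Vec n) : Prop :=
  ∃ r : ℝ, 0 < r ∧ ∀ x ∈ Metric.ball a r, ∀ z ∈ Metric.ball a r,
    f x + inner ℝ (gradient f x) (z - x) + c / 2 * ‖z - x‖ ^ 2 ≤ f z

/-- The Hessian of `f` is Lipschitz with constant `M` on a neighbourhood of `a`. -/
def HessianLocallyLipschitz {n : ℕ} (f : Vec n → ℝ) (M : ℝ) (a : Vec n) : Prop :=
  ∃ r : ℝ, 0 < r ∧ ∀ x ∈ Metric.ball a r, ∀ z ∈ Metric.ball a r,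
    ‖hess f x - hess f z‖ ≤ M * ‖x - z‖

namespace Problem

variable {n : ℕ} (P : Problem n)

/-- The objective `φ x = f x + lam * ‖x‖₀`. -/
def phi (x : Vec n) : ℝ := P.f x + P.lam * l0norm x

/-- The box `Ω = {x | -l ≤ x ≤ u}`. -/
def box : Set (Vec n) := {x | ∀ i, -P.l i ≤ x i ∧ x i ≤ P.u i}

/-- The projection onto the box, coordinatewise; `boxProj_mem` and `norm_sub_boxProj_le` show
that it is the minimizer of the distance over the box. -/
def boxProj (x : Vec n) : Vec n :=
  WithLp.toLp 2 fun i => max (-P.l i) (min (P.u i) (x i))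

theorem boxProj_mem (hl : ∀ i, 0 ≤ P.l i) (hu : ∀ i, 0 ≤ P.u i) (x : Vec n) :
    P.boxProj x ∈ P.box := by
  intro i
  have h1 := hl i
  have h2 := hu i
  refine ⟨le_max_left _ _, max_le (by linarith) (min_le_left _ _)⟩

theorem norm_sub_boxProj_le (x y : Vec n) (hy : y ∈ P.box) :
    ‖x - P.boxProj x‖ ≤ ‖x - y‖ := by
  rw [EuclideanSpace.norm_eq, EuclideanSpace.norm_eq]
  refine Real.sqrt_le_sqrt (Finset.sum_le_sum fun i _ => ?_)
  obtain ⟨h1, h2⟩ := hy i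
  rw [Real.norm_eq_abs, Real.norm_eq_abs, sq_abs, sq_abs, sq_le_sq]
  simp only [boxProj, PiLp.sub_apply]
  rcases le_total (P.u i) (x i) with h | h
  · rw [min_eq_left h, max_eq_right (h1.trans h2), abs_of_nonneg (by linarith),
      abs_of_nonneg (by linarith)]
    linarith
  · rw [min_eq_right h]
    rcases le_total (-P.l i) (x i) with h' | h'
    · simp [max_eq_right h']
    · rw [max_eq_left h', abs_of_nonpos (by linarith), abs_of_nonpos (by linarith)]
      linarith

/-- `a = min_i min (l_i², u_i²)`. -/
def a : ℝ := ⨅ i, min (P.l i ^ 2) (P.u i ^ 2)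

/-- `max_i |∇_i f(0)|`. -/
def gradZeroMax : ℝ := ⨆ i, |gradient P.f 0 i|

/-- The upper bound for `lam`: the minimum of `(τ/2) |∇_i f(0)|²` over the indices `i` with
`∇_i f(0) ≠ 0`. -/
def lamUpper (tau : ℝ) : ℝ :=
  ⨅ i : {i : Fin n // gradient P.f 0 i ≠ 0}, tau / 2 * |gradient P.f 0 i| ^ 2

/-- The forward step `z = x - τ ∇f(x)`. -/
def fwd (tau : ℝ) (x : Vec n) : Vec n := x - tau • gradient P.f x

/-- The inactive set `Θ_τ(x)`. -/
def inactive (tau : ℝ) (x : Vec n) : Finset (Fin n) :=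
  Finset.univ.filter fun i => -P.l i < P.fwd tau x i ∧ P.fwd tau x i < P.u i ∧
    Real.sqrt (2 * tau * P.lam) ≤ |P.fwd tau x i|

/-- The active set `Γ_τ(x)`. -/
def active (tau : ℝ) (x : Vec n) : Finset (Fin n) :=
  Finset.univ.filter fun i => P.u i ≤ P.fwd tau x i ∨ P.fwd tau x i ≤ -P.l i

/-- `I_τ(x) = Θ_τ(x) ∪ Γ_τ(x)`. -/
def idx (tau : ℝ) (x : Vec n) : Finset (Fin n) := P.inactive tau x ∪ P.active tau x

/-- `d` solves the Newton system `H d = -F_τ(x; Θ; Γ; Ī)` at `x`. The `Θ`-rows of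
`∇²_{ΘΘ}f d_Θ + ∇²_{ΘΓ}f d_Γ + ∇²_{ΘĪ}f d_Ī` are the `Θ`-rows of `∇²f(x) d`. -/
def IsNewtonDirection (tau : ℝ) (x d : Vec n) : Prop :=
  (∀ i ∈ P.inactive tau x, hess P.f x d i = -gradient P.f x i) ∧
  (∀ i ∈ P.active tau x, d i = P.boxProj (P.fwd tau x) i - x i) ∧
  (∀ i ∉ P.idx tau x, d i = -x i)

/-- The acceptance test for a Newton direction `d` at `x`; `Iprev` is the index set of the
previous iteration. -/
def NewtonTest (par : Params) (Iprev : Finset (Fin n)) (x d : Vec n) : Prop :=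
  (∑ i ∈ P.idx par.tau x, gradient P.f x i * d i ≤
    -par.delta * ‖d‖ ^ 2 + (∑ i ∈ (P.idx par.tau x)ᶜ, x i ^ 2) / (4 * par.tau)) ∧
  (P.idx par.tau x).card ≤ l0norm x ∧
  x + d ∈ P.box ∧
  ((P.inactive par.tau x \ Iprev).Nonempty ∨ P.idx par.tau x = Iprev)

/-- The trial point `x̃(α)` of the Newton step. -/
def newtonPoint (tau : ℝ) (x d : Vec n) (α : ℝ) : Vec n :=
  WithLp.toLp 2 fun i =>
    if i ∈ P.inactive tau x then x i + α * d i
    else if i ∈ P.active tau x then x i + d i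
    else 0

/-- The Armijo inequality with step size `β ^ m`. -/
def Armijo (par : Params) (x d : Vec n) (m : ℕ) : Prop :=
  P.f (P.newtonPoint par.tau x d (par.beta ^ m)) ≤
    P.f x + par.sigma * par.beta ^ m * inner ℝ (gradient P.f x) d

/-- One iteration from `x` to `y` in which the Newton direction `d` is accepted and the step size
is `β ^ m` with the smallest `m` satisfying the Armijo inequality. -/
def NewtonStep (par : Params) (Iprev : Finset (Fin n)) (x d y : Vec n) : Prop :=
  P.IsNewtonDirection par.tau x d ∧ P.NewtonTest par Iprev x d ∧
  ∃ m : ℕ, IsLeast {m | P.Armijo par x d m} m ∧ y = P.newtonPoint par.tau x d (par.beta ^ m)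

/-- One projected gradient iteration from `x` to `y` with direction `d`. -/
def GradientStep (par : Params) (x d y : Vec n) : Prop :=
  (∀ i ∈ P.idx par.tau x, d i = P.boxProj (P.fwd par.tau x) i - x i) ∧
  (∀ i ∉ P.idx par.tau x, d i = -x i) ∧
  y = x + d

/-- The index set of the iteration before `k` (empty for `k = 0`). -/
def prevIdx (tau : ℝ) (x : ℕ → Vec n) : ℕ → Finset (Fin n)
  | 0 => ∅
  | k + 1 => P.idx tau (x k)

/-- `x` is an infinite sequence of iterates with directions `d`, started in the box. A projected
gradient step is made when the Newton system is unsolvable or when the test fails for a solution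
of it (for a singular system any solution may be the computed one). -/
structure IsRun (par : Params) (x d : ℕ → Vec n) : Prop where
  init : x 0 ∈ P.box
  step : ∀ k,
    P.NewtonStep par (P.prevIdx par.tau x k) (x k) (d k) (x (k + 1)) ∨
    (((¬ ∃ d', P.IsNewtonDirection par.tau (x k) d') ∨
      (∃ d', P.IsNewtonDirection par.tau (x k) d' ∧
        ¬ P.NewtonTest par (P.prevIdx par.tau x k) (x k) d')) ∧
      P.GradientStep par (x k) (d k) (x (k + 1)))

/-- The constant `ᾱ`. -/
def alphaBar (par : Params) (L : ℝ) : ℝ :=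
  min (min ((1 - 2 * par.sigma) / (L / par.delta - par.sigma))
    (2 * (1 - par.sigma) * par.delta / L)) 1

/-- The constant `τ̄`. -/
def tauBar (par : Params) (L : ℝ) : ℝ :=
  min (2 * alphaBar par L * par.delta * par.beta / (n * L ^ 2)) <|
  min (alphaBar par L * par.beta / n) <|
  min (1 / (4 * L)) <|
  min (2 * (1 - par.sigma) / L) <|
  min (P.a / (2 * P.lam)) (P.a / (2 * P.gradZeroMax))

/-! The reduced problem for an index set `J`: minimize `f x` subject to `-l_i ≤ x_i ≤ u_i` for
`i ∈ J` and `x_i = 0` for `i ∉ J`. -/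

/-- The feasible set of the reduced problem. -/
def reducedSet (J : Finset (Fin n)) : Set (Vec n) :=
  {x | (∀ i ∈ J, -P.l i ≤ x i ∧ x i ≤ P.u i) ∧ ∀ i ∉ J, x i = 0}

/-- The linearized cone of the constraints of the reduced problem at `x`. -/
def linearizedCone (J : Finset (Fin n)) (x : Vec n) : Set (Vec n) :=
  {v | (∀ i ∈ J, (x i = P.u i → v i ≤ 0) ∧ (x i = -P.l i → 0 ≤ v i)) ∧ ∀ i ∉ J, v i = 0}

/-- Abadie's constraint qualification for the reduced problem at `x`: the (Bouligand) tangent cone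
equals the linearized cone. -/
def AbadieCQ (J : Finset (Fin n)) (x : Vec n) : Prop :=
  posTangentConeAt (P.reducedSet J) x = P.linearizedCone J x

/-- `ξ`, `η`, `ν` are Karush–Kuhn–Tucker multipliers at `x` of the upper bounds, the lower bounds
and the equality constraints of the reduced problem (extended by zero). -/
def IsKKT (J : Finset (Fin n)) (x ξ η ν : Vec n) : Prop :=
  x ∈ P.reducedSet J ∧
  gradient P.f x + ξ - η + ν = 0 ∧
  (∀ i ∈ J, 0 ≤ ξ i ∧ 0 ≤ η i ∧ ξ i * (x i - P.u i) = 0 ∧ η i * (x i + P.l i) = 0 ∧ ν i = 0) ∧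
  (∀ i ∉ J, ξ i = 0 ∧ η i = 0)

/-- Strict complementarity for the reduced problem at `x`: every bound that is active at `x` has
a positive multiplier. -/
def StrictComplementarity (J : Finset (Fin n)) (x : Vec n) : Prop :=
  ∀ ξ η ν : Vec n, P.IsKKT J x ξ η ν →
    ∀ i ∈ J, (x i = P.u i → 0 < ξ i) ∧ (x i = -P.l i → 0 < η i)

/-- `x` is a strict local minimizer of `φ` on the box. -/
def IsStrictLocalMin (x : Vec n) : Prop :=
  x ∈ P.box ∧ ∃ r : ℝ, 0 < r ∧ ∀ y ∈ P.box, y ≠ x → ‖y - x‖ < r → P.phi x < P.phi y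

end Problem

end BNL0R

end

namespace BNL0R

variable {n : ℕ}

/-! ### Coordinates -/

/-! Descent. A projected gradient step is a coordinatewise proximal step of the `ℓ₀` term over the
box, so it lowers `φ` by at least `L ‖d‖²` (`GradientStep.phi_le`). For a Newton step the obstacle
is the support that gets cut off. Each cut entry costs `λ`, but cutting is possible only when a new
index enters `Θ`, and such an entry bounds `λ` by a multiple of `‖d‖²` (`IsNewtonDirection.lam_le`).
Small `τ` makes the cost negligible, so backtracking stops at a step size at least `αβ`, or else the
support shrinks and `φ` drops by `λ` (`NewtonStep.phi_le`). As `φ` is bounded below, `‖d k‖ → 0`.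

Identification. An index that enters `I` needs a direction of length bounded away from zero, so the
index sets eventually decrease and stabilize at some `J`. Accumulation points are then fixed points
of the projected gradient map on `J`, vanish off `J`, and have nonzero entries on all of `J`. Strong
convexity gives an error bound in terms of `‖d k‖`, which confines the iterates near `x*` and yields
convergence (`IsRun.tendsto`).

Newton phase. Strict complementarity makes the gradient nonzero at active bounds, so near `x*` the
set `Γ` is exactly the set of active bounds and a full Newton step lands on them. What remains is a
smooth Newton method in the free coordinates: the Hessian is positive definite, the test and the
unit step are accepted (`IsStationary.eventually_newtonTest`), and the Taylor remainder of the
gradient gives the quadratic rate (`IsStationary.eventually_norm_add_sub_le`). -/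

theorem inner_eq_sum (x y : Vec n) : inner ℝ x y = ∑ i, x i * y i := by
  simp [PiLp.inner_apply, mul_comm]

theorem abs_coord_le_norm (x : Vec n) (i : Fin n) : |x i| ≤ ‖x‖ := by
  simpa using PiLp.norm_apply_le x i

theorem coord_sq_le_norm_sq (x : Vec n) (i : Fin n) : x i ^ 2 ≤ ‖x‖ ^ 2 := by
  rw [← sq_abs]
  exact pow_le_pow_left₀ (abs_nonneg _) (abs_coord_le_norm x i) 2

theorem norm_le_norm_of_abs_le {x y : Vec n} (h : ∀ i, |x i| ≤ |y i|) : ‖x‖ ≤ ‖y‖ := by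
  rw [← abs_of_nonneg (norm_nonneg x), ← abs_of_nonneg (norm_nonneg y), ← sq_le_sq,
    EuclideanSpace.real_norm_sq_eq, EuclideanSpace.real_norm_sq_eq]
  exact Finset.sum_le_sum fun i _ => sq_le_sq.2 (h i)

theorem mem_supp {x : Vec n} {i : Fin n} : i ∈ supp x ↔ x i ≠ 0 := by simp [supp]

theorem supp_subset_iff {x : Vec n} {J : Finset (Fin n)} : supp x ⊆ J ↔ ∀ i ∉ J, x i = 0 := by
  simp only [Finset.subset_iff, mem_supp]
  exact forall_congr' fun i => not_imp_comm

/-! ### Gradient and Hessian of a `C²` function -/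

section Calculus

variable {f : Vec n → ℝ}

theorem contDiff_gradient (hf : ContDiff ℝ 2 f) : ContDiff ℝ 1 (gradient f) := by
  have h : ContDiff ℝ 1 (fderiv ℝ f) := hf.fderiv_right (by norm_num)
  exact (InnerProductSpace.toDual ℝ (Vec n)).symm.toContinuousLinearEquiv.contDiff.comp h

theorem continuous_gradient (hf : ContDiff ℝ 2 f) : Continuous (gradient f) :=
  (contDiff_gradient hf).continuous

theorem hasFDerivAt_gradient (hf : ContDiff ℝ 2 f) (x : Vec n) :
    HasFDerivAt (gradient f) (hess f x) x :=
  ((contDiff_gradient hf).differentiable (by norm_num) x).hasFDerivAt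

theorem continuous_hess (hf : ContDiff ℝ 2 f) : Continuous (hess f) :=
  (contDiff_gradient hf).continuous_fderiv (by norm_num)

theorem hasDerivAt_comp_line (hf : ContDiff ℝ 2 f) (x v : Vec n) (t : ℝ) :
    HasDerivAt (fun t : ℝ => f (x + t • v)) (inner ℝ (gradient f (x + t • v)) v) t := by
  have h1 : HasGradientAt f (gradient f (x + t • v)) (x + t • v) :=
    (hf.differentiable (by norm_num) _).hasGradientAt
  have h2 : HasDerivAt (fun t : ℝ => x + t • v) v t := by
    simpa using ((hasDerivAt_id t).smul_const v).const_add x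
  exact h1.hasFDerivAt.comp_hasDerivAt t h2

theorem hasDerivAt_gradient_comp_line (hf : ContDiff ℝ 2 f) (x v : Vec n) (t : ℝ) :
    HasDerivAt (fun t : ℝ => gradient f (x + t • v)) (hess f (x + t • v) v) t := by
  have h2 : HasDerivAt (fun t : ℝ => x + t • v) v t := by
    simpa using ((hasDerivAt_id t).smul_const v).const_add x
  exact (hasFDerivAt_gradient hf _).comp_hasDerivAt t h2

/-- Second-order Taylor bound when the Hessian varies by at most `ε` on a ball. -/
theorem taylor_two_le (hf : ContDiff ℝ 2 f) {a x v : Vec n} {r ε : ℝ}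
    (hε : ∀ y ∈ Metric.ball a r, ‖hess f y - hess f x‖ ≤ ε)
    (hx : x ∈ Metric.ball a r) (hxv : x + v ∈ Metric.ball a r) :
    f (x + v) ≤ f x + inner ℝ (gradient f x) v + 1 / 2 * inner ℝ (hess f x v) v
      + ε * ‖v‖ ^ 2 := by
  have hball : ∀ t ∈ Icc (0 : ℝ) 1, x + t • v ∈ Metric.ball a r := fun t ht => by
    simpa using (convex_ball a r).add_smul_sub_mem hx hxv ht
  have hg : ∀ t ∈ Icc (0 : ℝ) 1,
      ‖gradient f (x + t • v) - gradient f x - t • hess f x v‖ ≤ ε * ‖v‖ := fun t ht => by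
    have h := Convex.norm_image_sub_le_of_norm_hasFDerivWithin_le'
      (fun y _ => (hasFDerivAt_gradient hf y).hasFDerivWithinAt) hε (convex_ball a r) hx
      (hball t ht)
    have hε0 : 0 ≤ ε := (norm_nonneg _).trans (hε x hx)
    simp only [add_sub_cancel_left, map_smul] at h
    refine h.trans (mul_le_mul_of_nonneg_left ?_ hε0)
    rw [norm_smul, Real.norm_of_nonneg ht.1]
    exact mul_le_of_le_one_left (norm_nonneg _) ht.2
  -- The derivative along the segment is compared with that of `B`. The gradient error is bounded
  -- uniformly in `t`, which costs `ε` in place of `ε / 2`.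
  have key := image_le_of_deriv_right_le_deriv_boundary (a := 0) (b := 1)
    (f := fun t : ℝ => f (x + t • v))
    (f' := fun t => inner ℝ (gradient f (x + t • v)) v)
    (B := fun t : ℝ => f x + t * inner ℝ (gradient f x) v + t ^ 2 / 2 * inner ℝ (hess f x v) v
      + t * (ε * ‖v‖ ^ 2))
    (B' := fun t => inner ℝ (gradient f x) v + t * inner ℝ (hess f x v) v + ε * ‖v‖ ^ 2)
    (fun t _ => (hasDerivAt_comp_line hf x v t).continuousAt.continuousWithinAt)
    (fun t _ => (hasDerivAt_comp_line hf x v t).hasDerivWithinAt)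
    (by simp) (by fun_prop)
    (fun t _ => by
      have h1 := (hasDerivAt_id t).mul_const (inner ℝ (gradient f x) v)
      have h2 := (((hasDerivAt_id t).pow 2).div_const 2).mul_const (inner ℝ (hess f x v) v)
      have h3 := (hasDerivAt_id t).mul_const (ε * ‖v‖ ^ 2)
      refine (((h1.const_add (f x)).add h2).add h3).hasDerivWithinAt.congr_deriv ?_
      simp)
    (fun t ht => by
      have h := (real_inner_le_norm (gradient f (x + t • v) - gradient f x - t • hess f x v) v).trans
        (mul_le_mul_of_nonneg_right (hg t (Ico_subset_Icc_self ht)) (norm_nonneg v))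
      rw [inner_sub_left, inner_sub_left, real_inner_smul_left] at h
      linarith)
    (x := 1) (by simp)
  simp only [one_smul, one_mul, one_pow] at key
  linarith

/-- First-order Taylor bound for the gradient when the Hessian is Lipschitz on a ball. -/
theorem norm_gradient_taylor_le (hf : ContDiff ℝ 2 f) {a x y : Vec n} {r M : ℝ}
    (hM : ∀ x ∈ Metric.ball a r, ∀ z ∈ Metric.ball a r, ‖hess f x - hess f z‖ ≤ M * ‖x - z‖)
    (hx : x ∈ Metric.ball a r) (hy : y ∈ Metric.ball a r) :
    ‖gradient f y - gradient f x - hess f x (y - x)‖ ≤ M / 2 * ‖y - x‖ ^ 2 := by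
  set v := y - x with hv
  have hball : ∀ t ∈ Icc (0 : ℝ) 1, x + t • v ∈ Metric.ball a r := fun t ht =>
    (convex_ball a r).add_smul_sub_mem hx hy ht
  have hder : ∀ t : ℝ, HasDerivAt
      (fun t : ℝ => gradient f (x + t • v) - gradient f x - t • hess f x v)
      (hess f (x + t • v) v - hess f x v) t := fun t => by
    have h := ((hasDerivAt_id t).smul_const (hess f x v))
    rw [one_smul] at h
    exact ((hasDerivAt_gradient_comp_line hf x v t).sub_const _).sub h
  -- Here the factor `t` in the Lipschitz bound is kept; integrating it produces the `1 / 2` of the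
  -- final rate.
  have key := image_norm_le_of_norm_deriv_right_le_deriv_boundary (a := 0) (b := 1)
    (f := fun t : ℝ => gradient f (x + t • v) - gradient f x - t • hess f x v)
    (f' := fun t => hess f (x + t • v) v - hess f x v)
    (B := fun t : ℝ => M * ‖v‖ ^ 2 * (t ^ 2 / 2)) (B' := fun t => M * ‖v‖ ^ 2 * t)
    (fun t _ => (hder t).continuousAt.continuousWithinAt)
    (fun t _ => (hder t).hasDerivWithinAt) (by simp)
    (fun t => by
      refine ((((hasDerivAt_id t).pow 2).div_const 2).const_mul (M * ‖v‖ ^ 2)).congr_deriv ?_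
      simp)
    (fun t ht => by
      have h := hM _ (hball t (Ico_subset_Icc_self ht)) x hx
      rw [add_sub_cancel_left, norm_smul, Real.norm_of_nonneg ht.1] at h
      calc ‖hess f (x + t • v) v - hess f x v‖ = ‖(hess f (x + t • v) - hess f x) v‖ := rfl
        _ ≤ ‖hess f (x + t • v) - hess f x‖ * ‖v‖ := ContinuousLinearMap.le_opNorm _ _
        _ ≤ M * (t * ‖v‖) * ‖v‖ := mul_le_mul_of_nonneg_right h (norm_nonneg v)
        _ = M * ‖v‖ ^ 2 * t := by ring)
    (x := 1) (by simp)
  simp only [one_smul, one_pow, hv, add_sub_cancel] at key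
  linarith

/-- Strong convexity on a ball makes the gradient strongly monotone there. -/
theorem strongly_monotone_gradient {c r : ℝ} {a : Vec n}
    (hc : ∀ x ∈ Metric.ball a r, ∀ z ∈ Metric.ball a r,
      f x + inner ℝ (gradient f x) (z - x) + c / 2 * ‖z - x‖ ^ 2 ≤ f z)
    {x z : Vec n} (hx : x ∈ Metric.ball a r) (hz : z ∈ Metric.ball a r) :
    c * ‖z - x‖ ^ 2 ≤ inner ℝ (gradient f z - gradient f x) (z - x) := by
  have h1 := hc x hx z hz
  have h2 := hc z hz x hx
  rw [← neg_sub z x, inner_neg_right, norm_neg] at h2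
  rw [inner_sub_left]
  linarith

/-- Strong convexity on a ball bounds the Hessian from below there. -/
theorem le_inner_hess (hf : ContDiff ℝ 2 f) {c r : ℝ} {a : Vec n}
    (hc : ∀ x ∈ Metric.ball a r, ∀ z ∈ Metric.ball a r,
      f x + inner ℝ (gradient f x) (z - x) + c / 2 * ‖z - x‖ ^ 2 ≤ f z)
    {x : Vec n} (hx : x ∈ Metric.ball a r) (v : Vec n) :
    c * ‖v‖ ^ 2 ≤ inner ℝ (hess f x v) v := by
  have hd := hasDerivAt_gradient_comp_line hf x v 0
  simp only [zero_smul, add_zero] at hd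
  -- Slopes from the right suffice: strong monotonicity bounds each of them, paired with `v`, below
  -- by `c ‖v‖²`.
  have hs := (hasDerivAt_iff_tendsto_slope_zero.1 hd).mono_left
    (nhdsWithin_mono 0 (fun t (ht : 0 < t) => ht.ne') : 𝓝[>] (0 : ℝ) ≤ 𝓝[≠] 0)
  have hs' := Filter.Tendsto.inner (𝕜 := ℝ) hs (tendsto_const_nhds (x := v))
  refine ge_of_tendsto hs' ?_
  have hcont : Continuous fun t : ℝ => x + t • v := by fun_prop
  have hnear : ∀ᶠ t in 𝓝[>] (0 : ℝ), x + t • v ∈ Metric.ball a r :=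
    (hcont.tendsto' 0 x (by simp)).mono_left nhdsWithin_le_nhds |>.eventually
      (Metric.isOpen_ball.mem_nhds hx)
  filter_upwards [hnear, self_mem_nhdsWithin] with t ht ht0
  have ht0 : 0 < t := ht0
  have h := strongly_monotone_gradient hc hx ht
  rw [add_sub_cancel_left, norm_smul, Real.norm_of_nonneg ht0.le, inner_smul_right] at h
  simp only [zero_add, zero_smul, add_zero]
  rw [real_inner_smul_left, ← div_eq_inv_mul, le_div_iff₀ ht0]
  refine le_of_mul_le_mul_left ?_ ht0
  linarith

end Calculus

/-! ### What the upper bound on the step size provides -/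

namespace Problem

variable {P : Problem n} {par : Params} {L α : ℝ}

/-- The standing assumptions of the descent analysis; `α` is the threshold below which the Armijo
inequality holds. -/
structure StepBounds (P : Problem n) (par : Params) (L α : ℝ) : Prop where
  lam_pos : 0 < P.lam
  L_pos : 0 < L
  tau_pos : 0 < par.tau
  delta_pos : 0 < par.delta
  sigma_pos : 0 < par.sigma
  sigma_lt : par.sigma < 1 / 2
  beta_pos : 0 < par.beta
  beta_lt : par.beta < 1
  alpha_pos : 0 < α
  alpha_le : α ≤ 1
  alpha_mul_le : α * (L - par.sigma * par.delta) ≤ (1 - 2 * par.sigma) * par.delta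
  tau_mul_le : n * par.tau * L ^ 2 ≤ 2 * α * par.delta * par.beta
  tau_mul_lt : 4 * L * par.tau < 1
  l_pos : ∀ i, 0 < P.l i
  u_pos : ∀ i, 0 < P.u i
  lt_l_sq : ∀ i, 2 * par.tau * P.lam < P.l i ^ 2
  lt_u_sq : ∀ i, 2 * par.tau * P.lam < P.u i ^ 2
  smooth : StronglySmooth P.f L
  hess_le : ∀ y ∈ P.box, ‖hess P.f y‖ ≤ L

/-- Since `0 < τ` lies below every entry of the minimum, all these entries are positive. With `x / 0
= 0` this rules out `n = 0` and forces `ᾱ > 0`, hence `L / δ > σ`. The entry `a / (2λ)` gives `2τλ <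
l i ^ 2` and `2τλ < u i ^ 2`, so no bound is zero. -/
theorem stepBounds_of_lt_tauBar (hl : ∀ i, 0 ≤ P.l i) (hu : ∀ i, 0 ≤ P.u i) (hlam : 0 < P.lam)
    (hL : 0 < L) (hsmooth : StronglySmooth P.f L) (hhess : ∀ y ∈ P.box, ‖hess P.f y‖ ≤ L)
    (hsigma : par.sigma ∈ Ioo (0 : ℝ) (1 / 2)) (hbeta : par.beta ∈ Ioo (0 : ℝ) 1)
    (hdelta : 0 < par.delta) (htau : par.tau ∈ Ioo (0 : ℝ) (P.tauBar par L)) :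
    P.StepBounds par L (alphaBar par L) := by
  obtain ⟨ht0, ht⟩ := htau
  simp only [tauBar, lt_min_iff] at ht
  obtain ⟨h1, -, h3, -, h5, -⟩ := ht
  have hden : 0 < n * L ^ 2 := by
    by_contra h
    have : n * L ^ 2 = 0 := le_antisymm (not_lt.1 h) (by positivity)
    rw [this, div_zero] at h1
    exact absurd (ht0.trans h1) (lt_irrefl _)
  have h1' := (lt_div_iff₀ hden).1 h1
  have hα : 0 < alphaBar par L := by
    by_contra h
    have : 2 * alphaBar par L * par.delta * par.beta ≤ 0 := by
      have := mul_nonneg (mul_nonneg (neg_nonneg.2 (not_lt.1 h)) hdelta.le) hbeta.1.le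
      linarith
    have := mul_pos ht0 hden
    linarith
  have hden2 : 0 < L / par.delta - par.sigma := by
    have h : 0 < (1 - 2 * par.sigma) / (L / par.delta - par.sigma) :=
      hα.trans_le ((min_le_left _ _).trans (min_le_left _ _))
    exact (div_pos_iff_of_pos_left (by linarith [hsigma.2])).1 h
  have hαmul : alphaBar par L * (L / par.delta - par.sigma) ≤ 1 - 2 * par.sigma :=
    (le_div_iff₀ hden2).1 ((min_le_left _ _).trans (min_le_left _ _))
  have ha : ∀ i, 2 * par.tau * P.lam < min (P.l i ^ 2) (P.u i ^ 2) := fun i => by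
    have h : P.a ≤ min (P.l i ^ 2) (P.u i ^ 2) := ciInf_le (Set.finite_range _).bddBelow i
    have h5' := (lt_div_iff₀ (by positivity)).1 h5
    linarith
  have hpos : ∀ {a : ℝ}, 0 ≤ a → 2 * par.tau * P.lam < a ^ 2 → 0 < a := fun h0 h =>
    h0.lt_of_ne fun h' => by
      rw [← h'] at h
      have : 0 < 2 * par.tau * P.lam := by positivity
      norm_num at h
      linarith
  have hll := fun i => (lt_min_iff.1 (ha i)).1
  have huu := fun i => (lt_min_iff.1 (ha i)).2
  refine ⟨hlam, hL, ht0, hdelta, hsigma.1, hsigma.2, hbeta.1, hbeta.2, hα, min_le_right _ _, ?_, ?_,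
    ?_, fun i => hpos (hl i) (hll i), fun i => hpos (hu i) (huu i), hll, huu, hsmooth, hhess⟩
  · have h := mul_le_mul_of_nonneg_right hαmul hdelta.le
    calc alphaBar par L * (L - par.sigma * par.delta)
        = alphaBar par L * (L / par.delta - par.sigma) * par.delta := by field_simp
      _ ≤ _ := h
  · linarith
  · have := (lt_div_iff₀ (by positivity)).1 h3
    linarith

/-! ### Index sets and the projection -/

theorem fwd_apply (tau : ℝ) (x : Vec n) (i : Fin n) :
    P.fwd tau x i = x i - tau * gradient P.f x i := rfl

theorem boxProj_apply (x : Vec n) (i : Fin n) :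
    P.boxProj x i = max (-P.l i) (min (P.u i) (x i)) := rfl

theorem mem_inactive {tau : ℝ} {x : Vec n} {i : Fin n} :
    i ∈ P.inactive tau x ↔ -P.l i < P.fwd tau x i ∧ P.fwd tau x i < P.u i ∧
      Real.sqrt (2 * tau * P.lam) ≤ |P.fwd tau x i| := by simp [inactive]

theorem mem_active {tau : ℝ} {x : Vec n} {i : Fin n} :
    i ∈ P.active tau x ↔ P.u i ≤ P.fwd tau x i ∨ P.fwd tau x i ≤ -P.l i := by simp [active]

theorem mem_idx {tau : ℝ} {x : Vec n} {i : Fin n} :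
    i ∈ P.idx tau x ↔ i ∈ P.inactive tau x ∨ i ∈ P.active tau x := Finset.mem_union

theorem disjoint_inactive_active (tau : ℝ) (x : Vec n) :
    Disjoint (P.inactive tau x) (P.active tau x) := by
  rw [Finset.disjoint_left]
  intro i h1 h2
  rw [mem_inactive] at h1
  rw [mem_active] at h2
  rcases h2 with h2 | h2 <;> linarith [h1.1, h1.2.1]

theorem boxProj_eq_self {z : Vec n} {i : Fin n} (h1 : -P.l i ≤ z i) (h2 : z i ≤ P.u i) :
    P.boxProj z i = z i := by
  rw [boxProj_apply, min_eq_right h2, max_eq_right h1]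

theorem StepBounds.neg_l_lt_u (h : P.StepBounds par L α) (i : Fin n) : -P.l i < P.u i := by
  linarith [h.l_pos i, h.u_pos i]

theorem StepBounds.boxProj_mem (h : P.StepBounds par L α) (z : Vec n) : P.boxProj z ∈ P.box :=
  Problem.boxProj_mem P (fun i => (h.l_pos i).le) (fun i => (h.u_pos i).le) z

theorem StepBounds.boxProj_eq_u (h : P.StepBounds par L α) {z : Vec n} {i : Fin n}
    (hz : P.u i ≤ z i) : P.boxProj z i = P.u i := by
  rw [boxProj_apply, min_eq_left hz, max_eq_right (h.neg_l_lt_u i).le]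

theorem StepBounds.boxProj_eq_neg_l (h : P.StepBounds par L α) {z : Vec n} {i : Fin n}
    (hz : z i ≤ -P.l i) : P.boxProj z i = -P.l i := by
  rw [boxProj_apply, min_eq_right (hz.trans (h.neg_l_lt_u i).le), max_eq_left hz]

theorem sqrt_le_abs_iff {tau lam z : ℝ} : Real.sqrt (2 * tau * lam) ≤ |z| ↔
    2 * tau * lam ≤ z ^ 2 := by
  rw [Real.sqrt_le_left (abs_nonneg _), sq_abs]

/-- `I_τ(x)` is the set of indices at which hard thresholding keeps the entry of `z`. -/
theorem StepBounds.mem_idx_iff (h : P.StepBounds par L α) {x : Vec n} {i : Fin n} :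
    i ∈ P.idx par.tau x ↔ 2 * par.tau * P.lam ≤ P.fwd par.tau x i ^ 2 := by
  have hl := h.l_pos i
  have hu := h.u_pos i
  have hl2 := h.lt_l_sq i
  have hu2 := h.lt_u_sq i
  rw [mem_idx, mem_inactive, mem_active, sqrt_le_abs_iff]
  constructor
  · rintro (h1 | h1 | h1)
    · exact h1.2.2
    · nlinarith
    · nlinarith
  · intro h1
    by_cases h2 : P.u i ≤ P.fwd par.tau x i
    · exact Or.inr (Or.inl h2)
    by_cases h3 : P.fwd par.tau x i ≤ -P.l i
    · exact Or.inr (Or.inr h3)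
    exact Or.inl ⟨not_le.1 h3, not_le.1 h2, h1⟩

/-- Projected entries over `I_τ(x)` are bounded away from zero. -/
theorem StepBounds.le_boxProj_sq (h : P.StepBounds par L α) {x : Vec n} {i : Fin n}
    (hi : i ∈ P.idx par.tau x) :
    2 * par.tau * P.lam ≤ P.boxProj (P.fwd par.tau x) i ^ 2 := by
  rcases le_or_gt (P.u i) (P.fwd par.tau x i) with h2 | h2
  · rw [h.boxProj_eq_u h2]
    exact (h.lt_u_sq i).le
  rcases le_or_gt (P.fwd par.tau x i) (-P.l i) with h3 | h3
  · rw [h.boxProj_eq_neg_l h3, neg_sq]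
    exact (h.lt_l_sq i).le
  · rw [boxProj_eq_self h3.le h2.le]
    exact h.mem_idx_iff.1 hi

/-- The obtuse angle property of the projection, coordinatewise. -/
theorem StepBounds.boxProj_obtuse (h : P.StepBounds par L α) (z : Vec n) {i : Fin n} {w : ℝ}
    (h1 : -P.l i ≤ w) (h2 : w ≤ P.u i) :
    (z i - P.boxProj z i) * (w - P.boxProj z i) ≤ 0 := by
  rcases le_or_gt (P.u i) (z i) with h3 | h3
  · rw [h.boxProj_eq_u h3]
    exact mul_nonpos_of_nonneg_of_nonpos (by linarith) (by linarith)
  rcases le_or_gt (z i) (-P.l i) with h4 | h4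
  · rw [h.boxProj_eq_neg_l h4]
    exact mul_nonpos_of_nonpos_of_nonneg (by linarith) (by linarith)
  · rw [boxProj_eq_self h4.le h3.le, sub_self, zero_mul]

theorem phi_eq (x : Vec n) : P.phi x = P.f x + ∑ i, if x i ≠ 0 then P.lam else 0 := by
  rw [phi, l0norm, supp, ← Finset.sum_filter, Finset.sum_const, nsmul_eq_mul, mul_comm]

/-! ### Projected gradient steps -/

theorem GradientStep.apply_of_mem {x d y : Vec n} (hs : P.GradientStep par x d y) {i : Fin n}
    (hi : i ∈ P.idx par.tau x) : y i = P.boxProj (P.fwd par.tau x) i := by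
  rw [hs.2.2, PiLp.add_apply, hs.1 i hi]
  ring

theorem GradientStep.apply_of_notMem {x d y : Vec n} (hs : P.GradientStep par x d y) {i : Fin n}
    (hi : i ∉ P.idx par.tau x) : y i = 0 := by
  rw [hs.2.2, PiLp.add_apply, hs.2.1 i hi]
  ring

theorem StepBounds.zero_mem_box (h : P.StepBounds par L α) (i : Fin n) :
    -P.l i ≤ 0 ∧ 0 ≤ P.u i := ⟨by linarith [h.l_pos i], (h.u_pos i).le⟩

theorem GradientStep.mem_box (h : P.StepBounds par L α) {x d y : Vec n}
    (hs : P.GradientStep par x d y) : y ∈ P.box := by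
  intro i
  by_cases hi : i ∈ P.idx par.tau x
  · rw [hs.apply_of_mem hi]
    exact h.boxProj_mem _ i
  · rw [hs.apply_of_notMem hi]
    exact h.zero_mem_box i

/-- `y i` minimizes `(w - z i)² + 2τλ·[w ≠ 0]` over the box interval. On `I` the projection beats
nonzero competitors by the obtuse angle property, and beats zero because `z i ^ 2` and the squared
bounds are at least `2τλ`. Off `I`, `z i ^ 2 < 2τλ` makes zero optimal. -/
theorem GradientStep.prox_le (h : P.StepBounds par L α) {x d y : Vec n} (hx : x ∈ P.box)
    (hs : P.GradientStep par x d y) (i : Fin n) :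
    (y i - P.fwd par.tau x i) ^ 2 + 2 * par.tau * (if y i ≠ 0 then P.lam else 0) ≤
      (x i - P.fwd par.tau x i) ^ 2 + 2 * par.tau * (if x i ≠ 0 then P.lam else 0) := by
  have hτ := h.tau_pos
  have hτl : 0 < 2 * par.tau * P.lam := mul_pos (by linarith) h.lam_pos
  have hxi := hx i
  by_cases hi : i ∈ P.idx par.tau x
  · have hy := hs.apply_of_mem hi
    have hy0 : y i ≠ 0 := by
      intro h0
      have := h.le_boxProj_sq hi
      rw [← hy, h0] at this
      norm_num at this
      linarith
    rw [if_pos hy0]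
    by_cases hx0 : x i = 0
    · rw [if_neg (not_not.2 hx0), hx0, hy]
      rcases le_or_gt (P.u i) (P.fwd par.tau x i) with h2 | h2
      · rw [h.boxProj_eq_u h2]
        nlinarith [h.lt_u_sq i, h.u_pos i]
      rcases le_or_gt (P.fwd par.tau x i) (-P.l i) with h3 | h3
      · rw [h.boxProj_eq_neg_l h3]
        nlinarith [h.lt_l_sq i, h.l_pos i]
      · rw [boxProj_eq_self h3.le h2.le]
        nlinarith [h.mem_idx_iff.1 hi]
    · rw [if_pos hx0, hy]
      have := h.boxProj_obtuse (P.fwd par.tau x) hxi.1 hxi.2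
      nlinarith [sq_nonneg (x i - P.boxProj (P.fwd par.tau x) i)]
  · rw [hs.apply_of_notMem hi, if_neg (not_not.2 rfl)]
    by_cases hx0 : x i = 0
    · rw [hx0]
      simp
    · rw [if_pos hx0]
      have := mt h.mem_idx_iff.2 hi
      nlinarith [sq_nonneg (x i - P.fwd par.tau x i)]

/-- Summing the proximal inequality and adding strong smoothness gives a decrease of `(1/(2τ) - L/2)
‖d‖²`, and `4Lτ < 1` makes this at least `L ‖d‖²`. -/
theorem GradientStep.phi_le (h : P.StepBounds par L α) {x d y : Vec n} (hx : x ∈ P.box)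
    (hs : P.GradientStep par x d y) : P.phi y ≤ P.phi x - L * ‖d‖ ^ 2 := by
  have hτ := h.tau_pos
  have hsm := h.smooth x y
  have hyx : y - x = d := by rw [hs.2.2, add_sub_cancel_left]
  rw [hyx] at hsm
  have hsum : 2 * par.tau * inner ℝ (gradient P.f x) d + ‖d‖ ^ 2 +
      2 * par.tau * (∑ i, if y i ≠ 0 then P.lam else 0) ≤
      2 * par.tau * (∑ i, if x i ≠ 0 then P.lam else 0) := by
    rw [inner_eq_sum, EuclideanSpace.real_norm_sq_eq, Finset.mul_sum, Finset.mul_sum,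
      Finset.mul_sum, ← Finset.sum_add_distrib, ← Finset.sum_add_distrib]
    refine Finset.sum_le_sum fun i _ => ?_
    have hp := hs.prox_le h hx i
    have hd : y i = x i + d i := by rw [hs.2.2, PiLp.add_apply]
    rw [fwd_apply] at hp
    have h1 : (y i - (x i - par.tau * gradient P.f x i)) ^ 2 =
        d i ^ 2 + 2 * par.tau * (gradient P.f x i * d i) +
          (x i - (x i - par.tau * gradient P.f x i)) ^ 2 := by
      rw [hd]
      ring
    rw [h1] at hp
    linarith
  rw [phi_eq, phi_eq]
  have hLd : 4 * L * par.tau * ‖d‖ ^ 2 ≤ ‖d‖ ^ 2 :=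
    mul_le_of_le_one_left (sq_nonneg _) h.tau_mul_lt.le
  refine le_of_mul_le_mul_left (a := 2 * par.tau) ?_ (by linarith)
  have hsm' := mul_le_mul_of_nonneg_left hsm (by linarith : 0 ≤ 2 * par.tau)
  have : 0 ≤ L * par.tau * ‖d‖ ^ 2 := by
    have := h.L_pos
    positivity
  linarith

/-! ### Newton steps -/

theorem sum_eq_add_add (tau : ℝ) (x : Vec n) (F : Fin n → ℝ) :
    ∑ i, F i = ∑ i ∈ P.inactive tau x, F i + ∑ i ∈ P.active tau x, F i +
      ∑ i ∈ (P.idx tau x)ᶜ, F i := by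
  rw [← Finset.sum_union (disjoint_inactive_active tau x)]
  exact (Finset.sum_add_sum_compl (P.idx tau x) F).symm

theorem newtonPoint_of_inactive {tau : ℝ} {x d : Vec n} {a : ℝ} {i : Fin n}
    (hi : i ∈ P.inactive tau x) : P.newtonPoint tau x d a i = x i + a * d i := by
  simp [newtonPoint, hi]

theorem newtonPoint_of_active {tau : ℝ} {x d : Vec n} {a : ℝ} {i : Fin n}
    (hi : i ∈ P.active tau x) : P.newtonPoint tau x d a i = x i + d i := by
  have hi' := Finset.disjoint_right.1 (disjoint_inactive_active tau x) hi
  simp [newtonPoint, hi, hi']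

theorem newtonPoint_of_notMem {tau : ℝ} {x d : Vec n} {a : ℝ} {i : Fin n}
    (hi : i ∉ P.idx tau x) : P.newtonPoint tau x d a i = 0 := by
  rw [mem_idx, not_or] at hi
  simp [newtonPoint, hi.1, hi.2]

theorem IsNewtonDirection.newtonPoint_sub {tau : ℝ} {x d : Vec n}
    (hd : P.IsNewtonDirection tau x d) (a : ℝ) (i : Fin n) :
    (P.newtonPoint tau x d a - x) i = if i ∈ P.inactive tau x then a * d i else d i := by
  rw [PiLp.sub_apply]
  split_ifs with h1
  · rw [newtonPoint_of_inactive h1]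
    ring
  by_cases h2 : i ∈ P.active tau x
  · rw [newtonPoint_of_active h2]
    ring
  · have h3 : i ∉ P.idx tau x := by
      rw [mem_idx]
      tauto
    rw [newtonPoint_of_notMem h3, hd.2.2 i h3]
    ring

theorem IsNewtonDirection.newtonPoint_one {tau : ℝ} {x d : Vec n}
    (hd : P.IsNewtonDirection tau x d) : P.newtonPoint tau x d 1 = x + d := by
  ext i
  have h := hd.newtonPoint_sub 1 i
  rw [one_mul, ite_self, PiLp.sub_apply] at h
  rw [PiLp.add_apply]
  linarith

theorem IsNewtonDirection.norm_newtonPoint_sub_le {tau : ℝ} {x d : Vec n}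
    (hd : P.IsNewtonDirection tau x d) {a : ℝ} (h0 : 0 ≤ a) (h1 : a ≤ 1) :
    ‖P.newtonPoint tau x d a - x‖ ≤ ‖d‖ := by
  refine norm_le_norm_of_abs_le fun i => ?_
  rw [hd.newtonPoint_sub]
  split_ifs
  · rw [abs_mul, abs_of_nonneg h0]
    exact mul_le_of_le_one_left (abs_nonneg _) h1
  · exact le_rfl

theorem IsNewtonDirection.newtonPoint_mem_box {tau : ℝ} {x d : Vec n}
    (hd : P.IsNewtonDirection tau x d) (hx : x ∈ P.box) (hxd : x + d ∈ P.box) {a : ℝ}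
    (h0 : 0 ≤ a) (h1 : a ≤ 1) : P.newtonPoint tau x d a ∈ P.box := by
  intro i
  have hxi := hx i
  have hdi := hxd i
  have h := hd.newtonPoint_sub a i
  rw [PiLp.sub_apply] at h
  rw [PiLp.add_apply] at hdi
  split_ifs at h
  · have h2 : P.newtonPoint tau x d a i = (1 - a) * x i + a * (x i + d i) := by linarith
    rw [h2]
    constructor <;> nlinarith
  · have h2 : P.newtonPoint tau x d a i = x i + d i := by linarith
    rw [h2]
    exact hdi

/-- The gradient on `Θ` is controlled by the Newton direction. -/
theorem IsNewtonDirection.abs_gradient_le (h : P.StepBounds par L α) {x d : Vec n}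
    (hd : P.IsNewtonDirection par.tau x d) (hx : x ∈ P.box) {i : Fin n}
    (hi : i ∈ P.inactive par.tau x) : |gradient P.f x i| ≤ L * ‖d‖ := by
  have h1 := hd.1 i hi
  rw [← abs_neg, ← h1]
  exact (abs_coord_le_norm _ i).trans ((ContinuousLinearMap.le_opNorm _ d).trans
    (mul_le_mul_of_nonneg_right (h.hess_le x hx) (norm_nonneg d)))

/-- A new index in `Θ` forces the Newton direction to be long. -/
theorem IsNewtonDirection.lam_le (h : P.StepBounds par L α) {x d : Vec n}
    (hd : P.IsNewtonDirection par.tau x d) (hx : x ∈ P.box) {J : Finset (Fin n)}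
    (hJ : supp x ⊆ J) (hne : (P.inactive par.tau x \ J).Nonempty) :
    P.lam ≤ par.tau * L ^ 2 / 2 * ‖d‖ ^ 2 := by
  obtain ⟨i, hi⟩ := hne
  rw [Finset.mem_sdiff] at hi
  have hτ := h.tau_pos
  -- At an index outside `J` the forward step is `-τ g i`, so membership in `Θ` reads `2τλ ≤ τ² g i
  -- ^ 2`, and the Newton row bounds `g i`.
  have h0 := supp_subset_iff.1 hJ i hi.2
  have h1 := h.mem_idx_iff.1 (mem_idx.2 (Or.inl hi.1))
  rw [fwd_apply, h0] at h1
  have h2 : gradient P.f x i ^ 2 ≤ (L * ‖d‖) ^ 2 :=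
    sq_le_sq' (by linarith [neg_abs_le (gradient P.f x i), hd.abs_gradient_le h hx hi.1])
      ((le_abs_self _).trans (hd.abs_gradient_le h hx hi.1))
  have h3 := mul_le_mul_of_nonneg_left h2 (sq_nonneg par.tau)
  refine le_of_mul_le_mul_left (a := 2 * par.tau) ?_ (by linarith)
  calc 2 * par.tau * P.lam ≤ par.tau ^ 2 * gradient P.f x i ^ 2 := by linarith
    _ ≤ par.tau ^ 2 * (L * ‖d‖) ^ 2 := h3
    _ = _ := by ring

/-- Expand `(x i - τ g i)² < 2τλ` and drop the square of `τ g i`. When `x i = 0` no `λ` is charged,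
so later only support indices off `I` are counted. -/
theorem StepBounds.neg_gradient_mul_le (h : P.StepBounds par L α) {x : Vec n} {i : Fin n}
    (hi : i ∉ P.idx par.tau x) : -(gradient P.f x i * x i) ≤
      (if x i ≠ 0 then P.lam else 0) - x i ^ 2 / (2 * par.tau) := by
  have hτ := h.tau_pos
  by_cases h0 : x i = 0
  · simp [h0]
  · rw [if_pos h0, le_sub_iff_add_le, ← le_sub_iff_add_le', div_le_iff₀ (by linarith)]
    have h1 := mt h.mem_idx_iff.2 hi
    rw [fwd_apply] at h1
    nlinarith [sq_nonneg (par.tau * gradient P.f x i)]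

/-- Bound for the part of `⟨∇f(x), d⟩` outside `I_τ(x)`. -/
theorem IsNewtonDirection.sum_compl_le (h : P.StepBounds par L α) {x d : Vec n}
    (hd : P.IsNewtonDirection par.tau x d) (hx : x ∈ P.box) {J : Finset (Fin n)}
    (hJ : supp x ⊆ J) (hcase : (P.inactive par.tau x \ J).Nonempty ∨ P.idx par.tau x = J) :
    ∑ i ∈ (P.idx par.tau x)ᶜ, gradient P.f x i * d i ≤
      (supp x \ P.idx par.tau x).card * (par.tau * L ^ 2 / 2) * ‖d‖ ^ 2 -
        (∑ i ∈ (P.idx par.tau x)ᶜ, d i ^ 2) / (2 * par.tau) := by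
  have h1 : ∑ i ∈ (P.idx par.tau x)ᶜ, gradient P.f x i * d i ≤
      ∑ i ∈ (P.idx par.tau x)ᶜ, ((if x i ≠ 0 then P.lam else 0) - d i ^ 2 / (2 * par.tau)) := by
    refine Finset.sum_le_sum fun i hi => ?_
    rw [Finset.mem_compl] at hi
    rw [hd.2.2 i hi, neg_sq, mul_neg]
    exact h.neg_gradient_mul_le hi
  have h2 : ∑ i ∈ (P.idx par.tau x)ᶜ, (if x i ≠ 0 then P.lam else 0) =
      (supp x \ P.idx par.tau x).card * P.lam := by
    rw [← Finset.sum_filter, Finset.sum_const, nsmul_eq_mul]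
    congr 3
    ext i
    simp [mem_supp, and_comm]
  rw [Finset.sum_sub_distrib, h2, ← Finset.sum_div] at h1
  refine h1.trans (sub_le_sub_right ?_ _)
  -- Either a new index of `Θ` lets `‖d‖²` pay for `λ`, or `supp x ⊆ J = I` and nothing is cut off.
  rcases hcase with hne | heq
  · rw [mul_assoc]
    exact mul_le_mul_of_nonneg_left (hd.lam_le h hx hJ hne) (Nat.cast_nonneg _)
  · rw [heq, Finset.sdiff_eq_empty_iff_subset.2 hJ]
    simp

/-- The scalar inequality behind the Armijo condition; `s` and `D` are the parts of `⟨∇f(x), d⟩`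
and of `‖d‖²` on the inactive, the active and the remaining indices, and `T = 1 / τ`. -/
theorem armijo_arith {s₁ s₂ s₃ D₁ D₂ D₃ a c σ δ L T : ℝ} (hD₁ : 0 ≤ D₁) (hD₂ : 0 ≤ D₂)
    (hD₃ : 0 ≤ D₃) (ha : 0 < a) (ha1 : a ≤ 1) (hσ : 0 < σ) (hσ2 : σ < 1 / 2)
    (hL : 0 < L) (hT : 4 * L ≤ T) (haL : a * (L - σ * δ) ≤ (1 - 2 * σ) * δ)
    (hc : c ≤ a * δ / 2)
    (h₁₂ : s₁ + s₂ ≤ -δ * (D₁ + D₂ + D₃) + D₃ * T / 4) (h₂ : s₂ ≤ -(D₂ * T))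
    (h₃ : s₃ ≤ c * (D₁ + D₂ + D₃) - D₃ * T / 2) :
    a * s₁ + s₂ + s₃ + L / 2 * (a ^ 2 * D₁ + D₂ + D₃) ≤ σ * a * (s₁ + s₂ + s₃) := by
  have hσa : σ * a ≤ 1 / 2 := by nlinarith
  -- For `c = aδ/2` this is `haL` multiplied by `a / 2`; it explains the first entry of `ᾱ`.
  have hk : -(a * (1 - σ) * δ) + (1 - σ * a) * c ≤ -(a ^ 2 * L / 2) := by
    have e1 : (1 - σ * a) * c ≤ (1 - σ * a) * (a * δ / 2) :=
      mul_le_mul_of_nonneg_left hc (by linarith)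
    have e2 := mul_le_mul_of_nonneg_left haL ha.le
    nlinarith
  -- The weights come from `a s₁ + s₂ + s₃ - σa(s₁ + s₂ + s₃) = a(1-σ)(s₁ + s₂) + (1-a)s₂ +
  -- (1-σa)s₃`.
  have e12 := mul_le_mul_of_nonneg_left h₁₂ (mul_nonneg ha.le (by linarith : 0 ≤ 1 - σ))
  have e2 := mul_le_mul_of_nonneg_left h₂ (by linarith : 0 ≤ 1 - a)
  have e3 := mul_le_mul_of_nonneg_left h₃ (by linarith : 0 ≤ 1 - σ * a)
  have eD := mul_le_mul_of_nonneg_right hk (by linarith : 0 ≤ D₁ + D₂ + D₃)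
  have k2 : 0 ≤ (1 - a) * (T - L) * D₂ :=
    mul_nonneg (mul_nonneg (by linarith) (by linarith)) hD₂
  have k2' : L / 2 * (1 - a ^ 2) * D₂ ≤ (1 - a) * L * D₂ := by
    refine mul_le_mul_of_nonneg_right ?_ hD₂
    nlinarith [mul_nonneg hL.le (sq_nonneg (1 - a))]
  have k3 : (a * (1 - σ) * T / 4 - (1 - σ * a) * T / 2 + L / 2) * D₃ ≤ 0 := by
    refine mul_nonpos_of_nonpos_of_nonneg ?_ hD₃
    have e : a * (1 - σ) * T ≤ (1 - σ * a) * T :=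
      mul_le_mul_of_nonneg_right (by nlinarith) (by linarith)
    have e' : 1 / 2 * T ≤ (1 - σ * a) * T := mul_le_mul_of_nonneg_right (by linarith) (by linarith)
    linarith
  have k4 : 0 ≤ a ^ 2 * L / 2 * D₃ := by positivity
  linarith

/-- The Armijo inequality holds for moderately small steps if `a` dominates the error term. -/
theorem IsNewtonDirection.armijo_le (h : P.StepBounds par L α) {x d : Vec n}
    (hd : P.IsNewtonDirection par.tau x d) (hx : x ∈ P.box) {J : Finset (Fin n)}
    (hJ : supp x ⊆ J) (ht : P.NewtonTest par J x d) {a : ℝ} (ha : 0 < a) (haα : a ≤ α)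
    (hN : (supp x \ P.idx par.tau x).card * (par.tau * L ^ 2 / 2) ≤ a * par.delta / 2) :
    P.f (P.newtonPoint par.tau x d a) ≤ P.f x + par.sigma * a * inner ℝ (gradient P.f x) d := by
  have hτ := h.tau_pos
  have hsm := h.smooth x (P.newtonPoint par.tau x d a)
  refine hsm.trans ?_
  rw [add_assoc]
  refine add_le_add_right ?_ _
  obtain ⟨htest, -, -, hcase⟩ := ht
  have h3 := hd.sum_compl_le h hx hJ hcase
  have hsplit := fun F => sum_eq_add_add (P := P) par.tau x F
  have hΓ : ∀ i ∈ P.active par.tau x, i ∉ P.inactive par.tau x := fun i hi =>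
    Finset.disjoint_right.1 (disjoint_inactive_active par.tau x) hi
  have hI : ∀ i ∈ (P.idx par.tau x)ᶜ, i ∉ P.inactive par.tau x := fun i hi hi' =>
    Finset.mem_compl.1 hi (mem_idx.2 (Or.inl hi'))
  have hin : inner ℝ (gradient P.f x) (P.newtonPoint par.tau x d a - x) =
      a * (∑ i ∈ P.inactive par.tau x, gradient P.f x i * d i) +
        ∑ i ∈ P.active par.tau x, gradient P.f x i * d i +
        ∑ i ∈ (P.idx par.tau x)ᶜ, gradient P.f x i * d i := by
    rw [inner_eq_sum, hsplit, Finset.mul_sum]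
    refine congrArg₂ _ (congrArg₂ _ ?_ ?_) ?_ <;> refine Finset.sum_congr rfl fun i hi => ?_
    · rw [hd.newtonPoint_sub, if_pos hi]
      ring
    · rw [hd.newtonPoint_sub, if_neg (hΓ i hi)]
    · rw [hd.newtonPoint_sub, if_neg (hI i hi)]
  have hnorm : ‖P.newtonPoint par.tau x d a - x‖ ^ 2 =
      a ^ 2 * (∑ i ∈ P.inactive par.tau x, d i ^ 2) + ∑ i ∈ P.active par.tau x, d i ^ 2 +
        ∑ i ∈ (P.idx par.tau x)ᶜ, d i ^ 2 := by
    rw [EuclideanSpace.real_norm_sq_eq, hsplit, Finset.mul_sum]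
    refine congrArg₂ _ (congrArg₂ _ ?_ ?_) ?_ <;> refine Finset.sum_congr rfl fun i hi => ?_
    · rw [hd.newtonPoint_sub, if_pos hi]
      ring
    · rw [hd.newtonPoint_sub, if_neg (hΓ i hi)]
    · rw [hd.newtonPoint_sub, if_neg (hI i hi)]
  -- On `Γ` the projected point is `x i + d i`; the obtuse angle property against `x i` gives `τ g i
  -- d i + d i ^ 2 ≤ 0`.
  have h2 : ∑ i ∈ P.active par.tau x, gradient P.f x i * d i ≤
      -((∑ i ∈ P.active par.tau x, d i ^ 2) * (1 / par.tau)) := by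
    rw [Finset.sum_mul, ← Finset.sum_neg_distrib]
    refine Finset.sum_le_sum fun i hi => ?_
    have hob := h.boxProj_obtuse (P.fwd par.tau x) (hx i).1 (hx i).2
    have hp : P.boxProj (P.fwd par.tau x) i = x i + d i := by
      rw [hd.2.1 i hi]
      ring
    rw [hp, fwd_apply] at hob
    rw [mul_one_div, ← neg_div, le_div_iff₀ hτ]
    linarith
  have hdd : ∑ i ∈ (P.idx par.tau x)ᶜ, x i ^ 2 = ∑ i ∈ (P.idx par.tau x)ᶜ, d i ^ 2 :=
    Finset.sum_congr rfl fun i hi => by rw [hd.2.2 i (Finset.mem_compl.1 hi), neg_sq]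
  rw [hdd, idx, Finset.sum_union (disjoint_inactive_active par.tau x), ← idx] at htest
  rw [EuclideanSpace.real_norm_sq_eq, hsplit] at htest h3
  rw [hin, hnorm, inner_eq_sum, hsplit]
  have ha1 : a ≤ 1 := haα.trans h.alpha_le
  have haL : a * (L - par.sigma * par.delta) ≤ (1 - 2 * par.sigma) * par.delta := by
    have hσ := h.sigma_lt
    rcases le_total 0 (L - par.sigma * par.delta) with hs | hs
    · exact (mul_le_mul_of_nonneg_right haα hs).trans h.alpha_mul_le
    · exact (mul_nonpos_of_nonneg_of_nonpos ha.le hs).trans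
        (mul_nonneg (by linarith) h.delta_pos.le)
  have hT : 4 * L ≤ 1 / par.tau := by
    rw [le_div_iff₀ hτ]
    exact h.tau_mul_lt.le
  have hsq : ∀ s : Finset (Fin n), 0 ≤ ∑ i ∈ s, d i ^ 2 := fun s =>
    Finset.sum_nonneg fun i _ => sq_nonneg _
  refine armijo_arith (T := 1 / par.tau) (hsq _) (hsq _) (hsq _) ha ha1 h.sigma_pos h.sigma_lt
    h.L_pos hT haL hN ?_ h2 ?_
  · refine htest.trans_eq ?_
    field_simp
  · refine h3.trans_eq ?_
    field_simp

/-- The slack over `4τ` that the test allows is absorbed by the term over `2τ` gained outside `I`.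
-/
theorem IsNewtonDirection.inner_le (h : P.StepBounds par L α) {x d : Vec n}
    (hd : P.IsNewtonDirection par.tau x d) (hx : x ∈ P.box) {J : Finset (Fin n)}
    (hJ : supp x ⊆ J) (ht : P.NewtonTest par J x d) {c : ℝ}
    (hN : (supp x \ P.idx par.tau x).card * (par.tau * L ^ 2 / 2) ≤ c) :
    inner ℝ (gradient P.f x) d ≤ (c - par.delta) * ‖d‖ ^ 2 := by
  have hτ := h.tau_pos
  obtain ⟨htest, -, -, hcase⟩ := ht
  have h3 := hd.sum_compl_le h hx hJ hcase
  have hdd : ∑ i ∈ (P.idx par.tau x)ᶜ, x i ^ 2 = ∑ i ∈ (P.idx par.tau x)ᶜ, d i ^ 2 :=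
    Finset.sum_congr rfl fun i hi => by rw [hd.2.2 i (Finset.mem_compl.1 hi), neg_sq]
  rw [hdd] at htest
  rw [inner_eq_sum, ← Finset.sum_add_sum_compl (P.idx par.tau x)]
  have h4 : (∑ i ∈ (P.idx par.tau x)ᶜ, d i ^ 2) / (4 * par.tau) ≤
      (∑ i ∈ (P.idx par.tau x)ᶜ, d i ^ 2) / (2 * par.tau) :=
    div_le_div_of_nonneg_left (Finset.sum_nonneg fun i _ => sq_nonneg _) (by linarith)
      (by linarith)
  have h5 := mul_le_mul_of_nonneg_right hN (sq_nonneg ‖d‖)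
  linarith

theorem l0norm_le_card {x : Vec n} {J : Finset (Fin n)} (h : supp x ⊆ J) : l0norm x ≤ J.card :=
  Finset.card_le_card h

theorem NewtonStep.apply_of_notMem {x d y : Vec n} {J : Finset (Fin n)}
    (hs : P.NewtonStep par J x d y) {i : Fin n} (hi : i ∉ P.idx par.tau x) : y i = 0 := by
  obtain ⟨-, -, m, -, rfl⟩ := hs
  exact newtonPoint_of_notMem hi

theorem NewtonStep.mem_box (h : P.StepBounds par L α) {x d y : Vec n} {J : Finset (Fin n)}
    (hs : P.NewtonStep par J x d y) (hx : x ∈ P.box) : y ∈ P.box := by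
  obtain ⟨hd, ht, m, -, rfl⟩ := hs
  exact hd.newtonPoint_mem_box hx ht.2.2.1 (pow_nonneg h.beta_pos.le m)
    (pow_le_one₀ h.beta_pos.le h.beta_lt.le)

theorem NewtonStep.norm_sub_le (h : P.StepBounds par L α) {x d y : Vec n} {J : Finset (Fin n)}
    (hs : P.NewtonStep par J x d y) : ‖y - x‖ ≤ ‖d‖ := by
  obtain ⟨hd, -, m, -, rfl⟩ := hs
  exact hd.norm_newtonPoint_sub_le (pow_nonneg h.beta_pos.le m)
    (pow_le_one₀ h.beta_pos.le h.beta_lt.le)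

/-- A Newton step either removes an index from the support, or decreases `φ` by a multiple of
`‖d‖²`. -/
theorem NewtonStep.phi_le (h : P.StepBounds par L α) {x d y : Vec n} {J : Finset (Fin n)}
    (hs : P.NewtonStep par J x d y) (hx : x ∈ P.box) (hJ : supp x ⊆ J) :
    P.phi y ≤ P.phi x - P.lam ∨
      P.phi y ≤ P.phi x - par.sigma * (α * par.beta) * (par.delta / 2) * ‖d‖ ^ 2 := by
  have hsupp : supp y ⊆ P.idx par.tau x := supp_subset_iff.2 fun i hi => hs.apply_of_notMem hi
  obtain ⟨hd, ht, m, hm, rfl⟩ := hs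
  have hβ := h.beta_pos
  have hβ1 := h.beta_lt
  have hδ := h.delta_pos
  have hα := h.alpha_pos
  have hσ := h.sigma_pos
  have hτL : 0 ≤ par.tau * L ^ 2 / 2 := by
    have := h.tau_pos
    positivity
  have hαβ : α * par.beta ≤ 1 := mul_le_one₀ h.alpha_le hβ.le hβ1.le
  have hcard := l0norm_le_card hsupp
  have harm : P.f _ ≤ _ := hm.1
  have hβm := pow_pos hβ m
  -- If `I` is smaller than the support, an entry disappears and `f` does not increase, so `φ` falls
  -- by `λ`. Otherwise the decrease comes from Armijo.
  rcases ht.2.1.lt_or_eq with hlt | heq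
  · left
    have hN : ((supp x \ P.idx par.tau x).card : ℝ) * (par.tau * L ^ 2 / 2) ≤ par.delta := by
      have h1 : ((supp x \ P.idx par.tau x).card : ℝ) ≤ n := by
        exact_mod_cast (Finset.card_le_univ _).trans_eq (Fintype.card_fin n)
      have h2 := mul_le_mul_of_nonneg_right h1 hτL
      have h3 := mul_le_of_le_one_left hδ.le hαβ
      have h4 := h.tau_mul_le
      linarith
    have hin := hd.inner_le h hx hJ ht hN
    rw [sub_self, zero_mul] at hin
    have h1 := mul_nonpos_of_nonneg_of_nonpos (mul_pos hσ hβm).le hin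
    have h2 : (l0norm (P.newtonPoint par.tau x d (par.beta ^ m)) : ℝ) + 1 ≤ l0norm x := by
      exact_mod_cast Nat.succ_le_of_lt (hcard.trans_lt hlt)
    have h3 := mul_le_mul_of_nonneg_left h2 h.lam_pos.le
    unfold phi
    linarith
  · right
    have hN : ((supp x \ P.idx par.tau x).card : ℝ) * (par.tau * L ^ 2 / 2) ≤
        α * par.beta * par.delta / 2 := by
      -- Sets of equal size have differences of equal size; these are disjoint, so at most `n / 2`
      -- entries are cut. This halves the error to `αβδ/2`.
      have h0 : (supp x \ P.idx par.tau x).card = (P.idx par.tau x \ supp x).card :=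
        Finset.card_sdiff_comm heq.symm
      have h00 : (supp x \ P.idx par.tau x).card + (P.idx par.tau x \ supp x).card ≤ n := by
        rw [← Finset.card_union_of_disjoint]
        · exact (Finset.card_le_univ _).trans_eq (Fintype.card_fin n)
        · exact disjoint_sdiff_sdiff
      have h1 : ((supp x \ P.idx par.tau x).card : ℝ) ≤ n / 2 := by
        have h2 : 2 * (supp x \ P.idx par.tau x).card ≤ n := by omega
        have h3 : (2 : ℝ) * (supp x \ P.idx par.tau x).card ≤ n := by exact_mod_cast h2
        linarith
      have h2 := mul_le_mul_of_nonneg_right h1 hτL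
      have h4 := h.tau_mul_le
      linarith
    -- The first power of `β` below `α` is at least `αβ` and satisfies Armijo, so the least exponent
    -- `m` does not exceed it.
    have hbig : α * par.beta ≤ par.beta ^ m := by
      obtain ⟨j, hj1, hj2⟩ := exists_nat_pow_near_of_lt_one hα h.alpha_le hβ hβ1
      have hle : α * par.beta ≤ par.beta ^ (j + 1) := by
        rw [pow_succ]
        exact mul_le_mul_of_nonneg_right hj2 hβ.le
      have hA : P.Armijo par x d (j + 1) :=
        hd.armijo_le h hx hJ ht (pow_pos hβ _) hj1.le (hN.trans (by
          have := mul_le_mul_of_nonneg_right hle hδ.le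
          linarith))
      exact hle.trans (pow_le_pow_of_le_one hβ.le hβ1.le (hm.2 hA))
    have hin := hd.inner_le h hx hJ ht (hN.trans (by
      have := mul_le_of_le_one_left hδ.le hαβ
      linarith : _ ≤ par.delta / 2))
    have hin' : inner ℝ (gradient P.f x) d ≤ -(par.delta / 2 * ‖d‖ ^ 2) := by linarith
    have h1 := mul_le_mul_of_nonneg_left hin' (mul_pos hσ hβm).le
    have h2 := mul_le_mul_of_nonneg_right (mul_le_mul_of_nonneg_left hbig hσ.le)
      (by positivity : 0 ≤ par.delta / 2 * ‖d‖ ^ 2)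
    have h3 : (l0norm (P.newtonPoint par.tau x d (par.beta ^ m)) : ℝ) ≤ l0norm x := by
      exact_mod_cast hcard.trans_eq heq
    have h4 := mul_le_mul_of_nonneg_left h3 h.lam_pos.le
    unfold phi
    linarith

section Run

variable {x d : ℕ → Vec n}

/-! ### Descent along a run -/

theorem IsRun.newtonStep_or_gradientStep (hrun : P.IsRun par x d) (k : ℕ) :
    P.NewtonStep par (P.prevIdx par.tau x k) (x k) (d k) (x (k + 1)) ∨
      P.GradientStep par (x k) (d k) (x (k + 1)) :=
  (hrun.step k).imp_right And.right

theorem IsRun.mem_box (h : P.StepBounds par L α) (hrun : P.IsRun par x d) (k : ℕ) :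
    x k ∈ P.box := by
  induction k with
  | zero => exact hrun.init
  | succ k ih =>
    rcases hrun.newtonStep_or_gradientStep k with hs | hs
    · exact hs.mem_box h ih
    · exact hs.mem_box h

theorem IsRun.apply_succ_of_notMem (hrun : P.IsRun par x d) {k : ℕ} {i : Fin n}
    (hi : i ∉ P.idx par.tau (x k)) : x (k + 1) i = 0 := by
  rcases hrun.newtonStep_or_gradientStep k with hs | hs
  · exact hs.apply_of_notMem hi
  · exact hs.apply_of_notMem hi

theorem IsRun.supp_succ_subset (hrun : P.IsRun par x d) (k : ℕ) :
    supp (x (k + 1)) ⊆ P.idx par.tau (x k) :=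
  supp_subset_iff.2 fun _ hi => hrun.apply_succ_of_notMem hi

theorem IsRun.norm_succ_sub_le (h : P.StepBounds par L α) (hrun : P.IsRun par x d) (k : ℕ) :
    ‖x (k + 1) - x k‖ ≤ ‖d k‖ := by
  rcases hrun.newtonStep_or_gradientStep k with hs | hs
  · exact hs.norm_sub_le h
  · rw [hs.2.2, add_sub_cancel_left]

/-- The index starts at `k + 1` because the descent estimate needs the support inside the previous
index set, which may fail for the starting point. -/
theorem IsRun.exists_phi_succ_le (h : P.StepBounds par L α) (hrun : P.IsRun par x d) :
    ∃ c > 0, ∀ k, P.phi (x (k + 2)) ≤ P.phi (x (k + 1)) - P.lam ∨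
      P.phi (x (k + 2)) ≤ P.phi (x (k + 1)) - c * ‖d (k + 1)‖ ^ 2 := by
  have hc' : 0 < par.sigma * (α * par.beta) * (par.delta / 2) := by
    have h1 := h.sigma_pos
    have h2 := h.alpha_pos
    have h3 := h.beta_pos
    have h4 := h.delta_pos
    positivity
  refine ⟨min L (par.sigma * (α * par.beta) * (par.delta / 2)), lt_min h.L_pos hc', fun k => ?_⟩
  have hmin := fun {b : ℝ} (hb : min L (par.sigma * (α * par.beta) * (par.delta / 2)) ≤ b) =>
    mul_le_mul_of_nonneg_right hb (sq_nonneg ‖d (k + 1)‖)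
  rcases hrun.newtonStep_or_gradientStep (k + 1) with hs | hs
  · refine (hs.phi_le h (hrun.mem_box h _) (hrun.supp_succ_subset k)).imp_right fun h1 => ?_
    linarith [hmin (min_le_right _ _)]
  · right
    linarith [hs.phi_le h (hrun.mem_box h _), hmin (min_le_left _ _)]

/-- The values of `φ` decrease and are bounded below, so the drops tend to zero. Drops below `λ`
exclude the first alternative and control `‖d‖²`. -/
theorem IsRun.tendsto_norm_d (h : P.StepBounds par L α) (hbdd : BddBelow (range P.f))
    (hrun : P.IsRun par x d) : Tendsto (fun k => ‖d k‖) atTop (𝓝 0) := by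
  obtain ⟨c, hc, hdrop⟩ := hrun.exists_phi_succ_le h
  have hanti : Antitone fun k => P.phi (x (k + 1)) := antitone_nat_of_succ_le fun k => by
    rcases hdrop k with h1 | h1
    · linarith [h.lam_pos]
    · linarith [mul_nonneg hc.le (sq_nonneg ‖d (k + 1)‖)]
  obtain ⟨b, hb⟩ := hbdd
  have hbdd' : BddBelow (range fun k => P.phi (x (k + 1))) := by
    refine ⟨b, ?_⟩
    rintro _ ⟨k, rfl⟩
    have h1 := hb ⟨x (k + 1), rfl⟩
    have h2 : 0 ≤ P.lam * (l0norm (x (k + 1)) : ℝ) := mul_nonneg h.lam_pos.le (Nat.cast_nonneg _)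
    simp only [phi]
    linarith
  have hlim := tendsto_atTop_ciInf hanti hbdd'
  have hdiff : Tendsto (fun k => P.phi (x (k + 1)) - P.phi (x (k + 2))) atTop (𝓝 0) := by
    have := hlim.sub (hlim.comp (tendsto_add_atTop_nat 1))
    rwa [sub_self] at this
  have hsq : Tendsto (fun k => ‖d (k + 1)‖ ^ 2) atTop (𝓝 0) := by
    have h0 := hdiff.const_mul c⁻¹
    rw [mul_zero] at h0
    refine tendsto_of_tendsto_of_tendsto_of_le_of_le' tendsto_const_nhds h0
      (Eventually.of_forall fun k => sq_nonneg _) ?_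
    filter_upwards [hdiff.eventually (gt_mem_nhds h.lam_pos)] with k hk
    rw [← div_eq_inv_mul, le_div_iff₀ hc]
    rcases hdrop k with h1 | h1 <;> linarith
  have hs := hsq.sqrt
  simp only [Real.sqrt_sq (norm_nonneg _), Real.sqrt_zero] at hs
  exact (tendsto_add_atTop_iff_nat 1).1 hs

/-! ### Identification of the index set -/

/-- A short direction cannot bring in an index. For Newton it would give `λ ≤ τ²L²λ < λ`; for a
gradient step the entry jumps from zero to a projected value whose square is at least `2τλ`. -/
theorem IsRun.idx_succ_subset (h : P.StepBounds par L α) (hrun : P.IsRun par x d) {k : ℕ}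
    (hk : ‖d (k + 1)‖ ^ 2 < 2 * par.tau * P.lam) :
    P.idx par.tau (x (k + 1)) ⊆ P.idx par.tau (x k) := by
  have hτ := h.tau_pos
  have hlam := h.lam_pos
  have hL := h.L_pos
  rcases hrun.newtonStep_or_gradientStep (k + 1) with ⟨hd, ht, -⟩ | hs
  · rcases ht.2.2.2 with hne | heq
    · exfalso
      have h1 := hd.lam_le h (hrun.mem_box h _) (hrun.supp_succ_subset k) hne
      have h2 : par.tau * L ^ 2 / 2 * ‖d (k + 1)‖ ^ 2 ≤
          par.tau * L ^ 2 / 2 * (2 * par.tau * P.lam) :=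
        mul_le_mul_of_nonneg_left hk.le (by positivity)
      have h3 : (L * par.tau) * (L * par.tau) < 1 :=
        mul_lt_one_of_nonneg_of_lt_one_left (by positivity) (by linarith [h.tau_mul_lt])
          (by linarith [h.tau_mul_lt])
      have h4 := mul_lt_mul_of_pos_right h3 hlam
      linarith
    · exact heq.subset
  · intro i hi
    by_contra hi'
    have h0 := hrun.apply_succ_of_notMem hi'
    have h1 := hs.1 i hi
    rw [h0, sub_zero] at h1
    have h2 := h.le_boxProj_sq hi
    rw [← h1] at h2
    linarith [coord_sq_le_norm_sq (d (k + 1)) i]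

theorem IsRun.exists_idx_eventually_eq (h : P.StepBounds par L α) (hbdd : BddBelow (range P.f))
    (hrun : P.IsRun par x d) : ∃ J, ∀ᶠ k in atTop, P.idx par.tau (x k) = J := by
  have hd := (hrun.tendsto_norm_d h hbdd).pow 2
  rw [zero_pow two_ne_zero] at hd
  have hpos : 0 < 2 * par.tau * P.lam := mul_pos (by linarith [h.tau_pos]) h.lam_pos
  obtain ⟨K, hK⟩ := eventually_atTop.1 (hd.eventually (gt_mem_nhds hpos))
  have hanti : Antitone fun k => P.idx par.tau (x (K + k)) := antitone_nat_of_succ_le fun k =>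
    hrun.idx_succ_subset h (hK (K + k + 1) (by omega))
  obtain ⟨N, hN⟩ := WellFoundedGT.monotone_chain_condition
    (α := (Finset (Fin n))ᵒᵈ) ⟨fun k => OrderDual.toDual (P.idx par.tau (x (K + k))), hanti.dual_right⟩
  refine ⟨P.idx par.tau (x (K + N)), eventually_atTop.2 ⟨K + N, fun k hk => ?_⟩⟩
  obtain ⟨m, rfl⟩ := Nat.exists_eq_add_of_le (show K ≤ k by omega)
  exact (hN m (by omega)).symm

/-- Both kinds of step control the projected gradient residual. On `Θ` it is `-τ g i`, and the
Newton row gives `|τ g i| ≤ τL ‖d‖ ≤ ‖d‖`. -/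
theorem IsRun.abs_boxProj_sub_le (h : P.StepBounds par L α) (hrun : P.IsRun par x d) {k : ℕ}
    {i : Fin n} (hi : i ∈ P.idx par.tau (x k)) :
    |P.boxProj (P.fwd par.tau (x k)) i - x k i| ≤ ‖d k‖ := by
  rcases hrun.newtonStep_or_gradientStep k with ⟨hd, -⟩ | hs
  · rcases mem_idx.1 hi with hi | hi
    · have h1 := mem_inactive.1 hi
      rw [boxProj_eq_self h1.1.le h1.2.1.le, fwd_apply, sub_sub_cancel_left, abs_neg, abs_mul,
        abs_of_pos h.tau_pos]
      have h2 := mul_le_mul_of_nonneg_left (hd.abs_gradient_le h (hrun.mem_box h k) hi)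
        h.tau_pos.le
      have h3 := h.tau_mul_lt
      have h4 := mul_pos h.L_pos h.tau_pos
      have h5 : L * par.tau * ‖d k‖ ≤ ‖d k‖ :=
        mul_le_of_le_one_left (norm_nonneg _) (by linarith)
      linarith
    · rw [← hd.2.1 i hi]
      exact abs_coord_le_norm _ i
  · rw [← hs.1 i hi]
    exact abs_coord_le_norm _ i

/-! ### Stationary points -/

/-- `a` is a fixed point of the projected gradient map on `J`, vanishes off `J`, and the forward
step is bounded away from zero on `J`. -/
structure IsStationary (P : Problem n) (tau : ℝ) (J : Finset (Fin n)) (a : Vec n) : Prop where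
  boxProj_eq : ∀ i ∈ J, P.boxProj (P.fwd tau a) i = a i
  eq_zero : ∀ i ∉ J, a i = 0
  le_sq : ∀ i ∈ J, 2 * tau * P.lam ≤ P.fwd tau a i ^ 2

theorem continuous_fwd_apply (hf : ContDiff ℝ 2 P.f) (tau : ℝ) (i : Fin n) :
    Continuous fun x => P.fwd tau x i := by
  have h := continuous_gradient hf
  simp only [fwd_apply]
  fun_prop

theorem IsRun.isStationary (h : P.StepBounds par L α) (hf : ContDiff ℝ 2 P.f)
    (hbdd : BddBelow (range P.f)) (hrun : P.IsRun par x d) {a : Vec n}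
    (ha : MapClusterPt a atTop x) {J : Finset (Fin n)}
    (hJ : ∀ᶠ k in atTop, P.idx par.tau (x k) = J) : P.IsStationary par.tau J a := by
  obtain ⟨ψ, hψ, hlim⟩ := ha.tendsto_subseq
  have hJψ := hψ.tendsto_atTop.eventually hJ
  have hd := (hrun.tendsto_norm_d h hbdd).comp hψ.tendsto_atTop
  have hz : ∀ i, Tendsto (fun k => P.fwd par.tau (x (ψ k)) i) atTop (𝓝 (P.fwd par.tau a i)) :=
    fun i => ((continuous_fwd_apply hf par.tau i).tendsto a).comp hlim
  have hx : ∀ i, Tendsto (fun k => x (ψ k) i) atTop (𝓝 (a i)) := fun i =>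
    ((by fun_prop : Continuous fun y : Vec n => y i).tendsto a).comp hlim
  refine ⟨fun i hi => ?_, fun i hi => ?_, fun i hi => ?_⟩
  · have h1 : Tendsto (fun k => P.boxProj (P.fwd par.tau (x (ψ k))) i - x (ψ k) i) atTop
        (𝓝 (P.boxProj (P.fwd par.tau a) i - a i)) := by
      simp only [boxProj_apply]
      exact (tendsto_const_nhds.max (tendsto_const_nhds.min (hz i))).sub (hx i)
    have h2 : Tendsto (fun k => P.boxProj (P.fwd par.tau (x (ψ k))) i - x (ψ k) i) atTop
        (𝓝 0) := by
      refine squeeze_zero_norm' ?_ hd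
      filter_upwards [hJψ] with k hk
      exact hrun.abs_boxProj_sub_le h (hk ▸ hi)
    exact sub_eq_zero.1 (tendsto_nhds_unique h1 h2)
  · refine tendsto_nhds_unique (hx i) (tendsto_const_nhds.congr' ?_)
    have hJ' : ∀ᶠ k in atTop, x k i = 0 := by
      refine (eventually_map (m := fun k => k + 1) (P := fun k => x k i = 0)).2 ?_ |>.filter_mono
        (map_add_atTop_eq_nat 1).ge
      filter_upwards [hJ] with k hk
      exact hrun.apply_succ_of_notMem (hk ▸ hi)
    filter_upwards [hψ.tendsto_atTop.eventually hJ'] with k hk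
    exact hk.symm
  · refine ge_of_tendsto ((hz i).pow 2) ?_
    filter_upwards [hJψ] with k hk
    exact h.mem_idx_iff.1 (hk ▸ hi)

theorem IsRun.eventually_apply_eq_zero (hrun : P.IsRun par x d) {J : Finset (Fin n)}
    (hJ : ∀ᶠ k in atTop, P.idx par.tau (x k) = J) : ∀ᶠ k in atTop, ∀ i ∉ J, x k i = 0 := by
  rw [← map_add_atTop_eq_nat 1, eventually_map]
  filter_upwards [hJ] with k hk i hi
  exact hrun.apply_succ_of_notMem (hk ▸ hi)

theorem IsStationary.mem_box (h : P.StepBounds par L α) {J : Finset (Fin n)} {a : Vec n}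
    (ha : P.IsStationary par.tau J a) : a ∈ P.box := by
  intro i
  by_cases hi : i ∈ J
  · rw [← ha.boxProj_eq i hi]
    exact h.boxProj_mem _ i
  · rw [ha.eq_zero i hi]
    exact h.zero_mem_box i

theorem IsStationary.cases (h : P.StepBounds par L α) {J : Finset (Fin n)} {a : Vec n}
    (ha : P.IsStationary par.tau J a) {i : Fin n} (hi : i ∈ J) :
    (a i = P.u i ∧ gradient P.f a i ≤ 0) ∨ (a i = -P.l i ∧ 0 ≤ gradient P.f a i) ∨
      gradient P.f a i = 0 := by
  have hτ := h.tau_pos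
  have h1 := ha.boxProj_eq i hi
  rcases le_or_gt (P.u i) (P.fwd par.tau a i) with h2 | h2
  · rw [h.boxProj_eq_u h2] at h1
    rw [fwd_apply, h1] at h2
    exact Or.inl ⟨h1.symm, nonpos_of_mul_nonpos_right (by linarith : par.tau * _ ≤ 0) hτ⟩
  rcases le_or_gt (P.fwd par.tau a i) (-P.l i) with h3 | h3
  · rw [h.boxProj_eq_neg_l h3] at h1
    rw [fwd_apply, ← h1] at h3
    exact Or.inr (Or.inl ⟨h1.symm, nonneg_of_mul_nonneg_right (by linarith : 0 ≤ par.tau * _) hτ⟩)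
  · rw [boxProj_eq_self h3.le h2.le, fwd_apply, sub_eq_self] at h1
    exact Or.inr (Or.inr ((mul_eq_zero.1 h1).resolve_left hτ.ne'))

/-- A zero entry lies strictly inside its bounds, so its gradient entry vanishes and the forward
step would be zero, against `le_sq`. -/
theorem IsStationary.ne_zero (h : P.StepBounds par L α) {J : Finset (Fin n)} {a : Vec n}
    (ha : P.IsStationary par.tau J a) {i : Fin n} (hi : i ∈ J) : a i ≠ 0 := by
  intro h0
  have hpos : 0 < 2 * par.tau * P.lam := mul_pos (by linarith [h.tau_pos]) h.lam_pos
  have hl := h.l_pos i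
  have hu := h.u_pos i
  rcases ha.cases h hi with h1 | h1 | h1
  · linarith [h1.1]
  · linarith [h1.1]
  · have h2 := ha.le_sq i hi
    rw [fwd_apply, h0, h1] at h2
    norm_num at h2
    linarith

theorem IsStationary.supp_eq (h : P.StepBounds par L α) {J : Finset (Fin n)} {a : Vec n}
    (ha : P.IsStationary par.tau J a) : supp a = J := by
  ext i
  rw [mem_supp]
  exact ⟨fun h0 => by_contra fun hi => h0 (ha.eq_zero i hi), fun hi => ha.ne_zero h hi⟩

/-- Strict complementarity fixes the sign of the gradient at active bounds. -/
theorem IsStationary.gradient_sign (h : P.StepBounds par L α) {J : Finset (Fin n)} {a : Vec n}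
    (ha : P.IsStationary par.tau J a) (hSC : P.StrictComplementarity J a) {i : Fin n}
    (hi : i ∈ J) : (a i = P.u i → gradient P.f a i < 0) ∧
      (a i = -P.l i → 0 < gradient P.f a i) := by
  set g := gradient P.f a with hg
  -- The multipliers are the negative and positive parts of the gradient on `J`, and `-g` off `J`.
  have hkkt : P.IsKKT J a (WithLp.toLp 2 fun i => if i ∈ J then max (-g i) 0 else 0)
      (WithLp.toLp 2 fun i => if i ∈ J then max (g i) 0 else 0)
      (WithLp.toLp 2 fun i => if i ∈ J then 0 else -g i) := by
    refine ⟨⟨fun i _ => ha.mem_box h i, ha.eq_zero⟩, ?_, fun i hi => ?_, fun i hi => ?_⟩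
    · ext i
      by_cases hi : i ∈ J
      · rcases le_total 0 (g i) with h0 | h0 <;> simp [← hg, hi, h0]
      · simp [← hg, hi]
    · simp only [hi, if_true]
      refine ⟨le_max_right _ _, le_max_right _ _, ?_, ?_, trivial⟩ <;>
        rcases ha.cases h hi with h1 | h1 | h1 <;> simp [hg, h1]
    · simp [hi]
  have h1 := hSC _ _ _ hkkt i hi
  simp only [hi, if_true, lt_max_iff, lt_irrefl, or_false, neg_pos] at h1
  exact h1

/-! ### Convergence of the whole sequence -/

/-- Error bound: near a stationary point, the distance is controlled by the residual of the
projected gradient map. -/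
theorem IsStationary.error_bound (h : P.StepBounds par L α) {J : Finset (Fin n)} {a y : Vec n}
    {c r ρ : ℝ} (ha : P.IsStationary par.tau J a)
    (hc : ∀ x ∈ Metric.ball a r, ∀ z ∈ Metric.ball a r,
      P.f x + inner ℝ (gradient P.f x) (z - x) + c / 2 * ‖z - x‖ ^ 2 ≤ P.f z)
    (hy : y ∈ Metric.ball a r) (hyJ : ∀ i ∉ J, y i = 0)
    (hρ : ∀ i ∈ J, |P.boxProj (P.fwd par.tau y) i - y i| ≤ ρ) :
    par.tau * (c * ‖y - a‖ ^ 2) ≤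
      J.card * (ρ * (par.tau * ‖gradient P.f y - gradient P.f a‖ + ‖y - a‖)) := by
  have hτ := h.tau_pos
  have har : a ∈ Metric.ball a r :=
    Metric.mem_ball_self (dist_nonneg.trans_lt (Metric.mem_ball.1 hy))
  have h1 := mul_le_mul_of_nonneg_left (strongly_monotone_gradient hc har hy) hτ.le
  refine h1.trans ?_
  rw [inner_eq_sum, ← Finset.sum_subset (Finset.subset_univ J) (fun i _ hi => by
    rw [PiLp.sub_apply _ y a i, hyJ i hi, ha.eq_zero i hi, sub_zero, mul_zero]), Finset.mul_sum,
    ← nsmul_eq_mul]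
  refine Finset.sum_le_card_nsmul _ _ _ fun i hi => ?_
  have hab := ha.mem_box h i
  have hpb := h.boxProj_mem (P.fwd par.tau y) i
  -- Two variational inequalities, at `y` against `a i` and at `a` against the projection from `y`,
  -- are added; the square `(p - y i)²` is discarded.
  have e1 := h.boxProj_obtuse (P.fwd par.tau y) hab.1 hab.2
  have e2 := h.boxProj_obtuse (P.fwd par.tau a) hpb.1 hpb.2
  rw [ha.boxProj_eq i hi] at e2
  set p := P.boxProj (P.fwd par.tau y) i
  rw [fwd_apply] at e1 e2
  have hG := abs_coord_le_norm (gradient P.f y - gradient P.f a) i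
  have hE := abs_coord_le_norm (y - a) i
  rw [PiLp.sub_apply] at hG hE
  rw [PiLp.sub_apply, PiLp.sub_apply]
  have h3 : par.tau * ((gradient P.f y i - gradient P.f a i) * (y i - a i)) ≤
      -((p - y i) * (par.tau * (gradient P.f y i - gradient P.f a i) + (y i - a i))) := by
    nlinarith [sq_nonneg (p - y i)]
  refine h3.trans ((neg_le_abs _).trans ?_)
  rw [abs_mul]
  refine mul_le_mul (hρ i hi) ?_ (abs_nonneg _) ((abs_nonneg _).trans (hρ i hi))
  refine (abs_add_le _ _).trans (add_le_add ?_ hE)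
  rw [abs_mul, abs_of_pos hτ]
  exact mul_le_mul_of_nonneg_left hG hτ.le

/-- By the error bound, a late iterate in a fixed ball around `a` is arbitrarily close to `a`. As
step lengths tend to zero, the sequence cannot leave the ball after a late visit. -/
theorem IsRun.tendsto (h : P.StepBounds par L α) (hf : ContDiff ℝ 2 P.f)
    (hbdd : BddBelow (range P.f)) (hrun : P.IsRun par x d) {a : Vec n} {c : ℝ} (hc0 : 0 < c)
    (hc : LocallyStronglyConvex P.f c a) (hacc : MapClusterPt a atTop x) :
    Tendsto x atTop (𝓝 a) := by
  obtain ⟨J, hJ⟩ := hrun.exists_idx_eventually_eq h hbdd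
  have ha := hrun.isStationary h hf hbdd hacc hJ
  have hτ := h.tau_pos
  obtain ⟨r, hr, hc⟩ := hc
  obtain ⟨r₁, hr₁, hg⟩ := Metric.continuous_iff.1 (continuous_gradient hf) a 1 one_pos
  -- In this ball the bracket of the error bound is at most `τ + 1`.
  set R := min (min r r₁) 1 with hR
  have hR0 : 0 < R := lt_min (lt_min hr hr₁) one_pos
  have hd := hrun.tendsto_norm_d h hbdd
  have hlim : Tendsto (fun k => J.card * (‖d k‖ * (par.tau + 1))) atTop (𝓝 0) := by
    have := (hd.mul_const (par.tau + 1)).const_mul (J.card : ℝ)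
    rwa [zero_mul, mul_zero] at this
  have hcontract : ∀ ε > 0, ∀ᶠ k in atTop, dist (x k) a < R → dist (x k) a < ε := by
    intro ε hε
    have hpos : 0 < par.tau * (c * ε ^ 2) := by positivity
    filter_upwards [hJ, hrun.eventually_apply_eq_zero hJ, hlim.eventually (gt_mem_nhds hpos)]
      with k hk1 hk2 hk3 hk4
    have hkr : dist (x k) a < r := hk4.trans_le ((min_le_left _ _).trans (min_le_left _ _))
    have hkg := hg (x k) (hk4.trans_le ((min_le_left _ _).trans (min_le_right _ _)))
    have hk1' : dist (x k) a < 1 := hk4.trans_le (min_le_right _ _)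
    have heb := ha.error_bound h hc hkr hk2
      (fun i hi => hrun.abs_boxProj_sub_le h (hk1 ▸ hi : i ∈ P.idx par.tau (x k)))
    rw [dist_eq_norm] at hkg hk1' ⊢
    have hle : J.card * (‖d k‖ * (par.tau * ‖gradient P.f (x k) - gradient P.f a‖ + ‖x k - a‖))
        ≤ J.card * (‖d k‖ * (par.tau + 1)) := by
      gcongr
      · exact mul_le_of_le_one_right hτ.le hkg.le
    have hlt := (heb.trans hle).trans_lt hk3
    have hlt' := lt_of_mul_lt_mul_left (lt_of_mul_lt_mul_left hlt hτ.le) hc0.le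
    exact lt_of_pow_lt_pow_left₀ 2 hε.le hlt'
  have hstep : ∀ᶠ k in atTop, ‖d k‖ < R / 2 := hd.eventually (gt_mem_nhds (half_pos hR0))
  obtain ⟨K, hK⟩ := eventually_atTop.1 (hstep.and (hcontract (R / 2) (half_pos hR0)))
  have hfreq : ∃ᶠ k in atTop, dist (x k) a < R := hacc.frequently (Metric.ball_mem_nhds a hR0)
  obtain ⟨k₀, hk₀, hk₀R⟩ := frequently_atTop.1 hfreq K
  have hstay : ∀ k ≥ k₀, dist (x k) a < R := by
    intro k hk
    induction k, hk using Nat.le_induction with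
    | base => exact hk₀R
    | succ k hk ih =>
      obtain ⟨h1, h2⟩ := hK k (hk₀.trans hk)
      have h3 := hrun.norm_succ_sub_le h k
      rw [← dist_eq_norm] at h3
      linarith [dist_triangle (x (k + 1)) (x k) a, h2 ih]
  refine Metric.tendsto_nhds.2 fun ε hε => ?_
  filter_upwards [hcontract ε hε, eventually_ge_atTop k₀] with k h1 h2
  exact h1 (hstay k h2)

/-- Under strong convexity, stationary points are strict local minimizers. -/
theorem IsStationary.isStrictLocalMin (h : P.StepBounds par L α) (hf : ContDiff ℝ 2 P.f)
    {J : Finset (Fin n)} {a : Vec n} (ha : P.IsStationary par.tau J a) {c : ℝ} (hc0 : 0 < c)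
    (hc : LocallyStronglyConvex P.f c a) : P.IsStrictLocalMin a := by
  obtain ⟨r, hr, hc⟩ := hc
  have hnear : ∀ᶠ y in 𝓝 a, P.f a - P.lam < P.f y ∧ ∀ i ∈ J, y i ≠ 0 := by
    refine (hf.continuous.continuousAt.eventually (lt_mem_nhds (by linarith [h.lam_pos]))).and ?_
    refine (Finset.eventually_all J).2 fun i hi => ?_
    exact (by fun_prop : Continuous fun y : Vec n => y i).continuousAt.eventually_ne
      (ha.ne_zero h hi)
  obtain ⟨r₁, hr₁, hnear⟩ := Metric.eventually_nhds_iff.1 hnear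
  refine ⟨ha.mem_box h, min r r₁, lt_min hr hr₁, fun y hy hya hdist => ?_⟩
  rw [← dist_eq_norm] at hdist
  obtain ⟨h1, h2⟩ := hnear (hdist.trans_le (min_le_right _ _))
  have hsub : J ⊆ supp y := fun i hi => mem_supp.2 (h2 i hi)
  have hca : l0norm a = J.card := by rw [l0norm, ha.supp_eq h]
  unfold phi
  rw [hca]
  -- With equal support, convexity and the sign conditions decide. A larger support costs at least
  -- `λ`, more than `f` can gain nearby.
  rcases hsub.eq_or_ssubset with heq | hss
  · have hcy : l0norm y = J.card := by rw [l0norm, heq]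
    have hyc := hc a (Metric.mem_ball_self hr) y (hdist.trans_le (min_le_left _ _))
    have hin : 0 ≤ inner ℝ (gradient P.f a) (y - a) := by
      rw [inner_eq_sum]
      refine Finset.sum_nonneg fun i _ => ?_
      rw [PiLp.sub_apply]
      have hyi := hy i
      by_cases hi : i ∈ J
      · rcases ha.cases h hi with h3 | h3 | h3
        · exact mul_nonneg_of_nonpos_of_nonpos h3.2 (by linarith [h3.1])
        · exact mul_nonneg h3.2 (by linarith [h3.1])
        · rw [h3, zero_mul]
      · have hyi0 : y i = 0 := supp_subset_iff.1 heq.ge i hi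
        rw [hyi0, ha.eq_zero i hi, sub_zero, mul_zero]
    have hpos : 0 < c / 2 * ‖y - a‖ ^ 2 := by
      have := norm_pos_iff.2 (sub_ne_zero.2 hya)
      positivity
    rw [hcy]
    linarith
  · have hcy : (J.card : ℝ) + 1 ≤ l0norm y := by
      exact_mod_cast Nat.succ_le_of_lt (Finset.card_lt_card hss)
    have := mul_le_mul_of_nonneg_left hcy h.lam_pos.le
    linarith

end Run

/-! ### Newton directions near a stationary point -/

/-- The system operator has Hessian rows on `Θ` and identity rows elsewhere. A kernel vector
satisfies `⟨Hv, v⟩ = 0`, hence is zero; in finite dimension injectivity gives solvability. -/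
theorem exists_isNewtonDirection {tau c : ℝ} {y : Vec n} (hc0 : 0 < c)
    (hH : ∀ v, c * ‖v‖ ^ 2 ≤ inner ℝ (hess P.f y v) v) : ∃ d, P.IsNewtonDirection tau y d := by
  let T : Vec n →ₗ[ℝ] Vec n :=
    { toFun := fun v => WithLp.toLp 2 fun i => if i ∈ P.inactive tau y then hess P.f y v i else v i
      map_add' := fun v w => by
        ext i
        by_cases hi : i ∈ P.inactive tau y <;> simp [hi]
      map_smul' := fun t v => by
        ext i
        by_cases hi : i ∈ P.inactive tau y <;> simp [hi] }
  have hT : ∀ v i, T v i = if i ∈ P.inactive tau y then hess P.f y v i else v i := fun _ _ => rfl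
  have hinj : Function.Injective T := by
    rw [← LinearMap.ker_eq_bot, LinearMap.ker_eq_bot']
    intro v hv
    have h0 : inner ℝ (hess P.f y v) v = 0 := by
      rw [inner_eq_sum]
      refine Finset.sum_eq_zero fun i _ => ?_
      have h1 := hT v i
      rw [hv, PiLp.zero_apply] at h1
      split_ifs at h1
      · rw [← h1, zero_mul]
      · rw [← h1, mul_zero]
    have h1 := hH v
    rw [h0] at h1
    have h2 : ‖v‖ ^ 2 = 0 := le_antisymm (nonpos_of_mul_nonpos_right h1 hc0) (sq_nonneg _)
    exact norm_eq_zero.1 (pow_eq_zero_iff two_ne_zero |>.1 h2)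
  obtain ⟨d, hd⟩ := LinearMap.injective_iff_surjective.1 hinj
    (WithLp.toLp 2 fun i => if i ∈ P.inactive tau y then -gradient P.f y i
      else if i ∈ P.active tau y then P.boxProj (P.fwd tau y) i - y i else -y i)
  have hd' : ∀ i, (if i ∈ P.inactive tau y then hess P.f y d i else d i) =
      if i ∈ P.inactive tau y then -gradient P.f y i
      else if i ∈ P.active tau y then P.boxProj (P.fwd tau y) i - y i else -y i := fun i =>
    (hT d i).symm.trans (congrArg (fun v : Vec n => v i) hd)
  refine ⟨d, fun i hi => ?_, fun i hi => ?_, fun i hi => ?_⟩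
  · have h1 := hd' i
    rwa [if_pos hi, if_pos hi] at h1
  · have h1 := hd' i
    have hi' := Finset.disjoint_right.1 (disjoint_inactive_active tau y) hi
    rwa [if_neg hi', if_neg hi', if_pos hi] at h1
  · have h1 := hd' i
    rw [mem_idx, not_or] at hi
    rwa [if_neg hi.1, if_neg hi.1, if_neg hi.2] at h1

/-- In each term of `⟨Hd, d⟩` one factor is small: `Hd = -g` on `Θ`, `d` on `Γ`, and `d = 0`
elsewhere. -/
theorem IsNewtonDirection.norm_mul_le {tau c ρ : ℝ} {y d : Vec n} (hL : 0 ≤ L)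
    (hH : ∀ v, c * ‖v‖ ^ 2 ≤ inner ℝ (hess P.f y v) v) (hHL : ‖hess P.f y‖ ≤ L)
    (hd : P.IsNewtonDirection tau y d) (hρ0 : 0 ≤ ρ) (hy : ∀ i ∉ P.idx tau y, y i = 0)
    (hΘ : ∀ i ∈ P.inactive tau y, |gradient P.f y i| ≤ ρ)
    (hΓ : ∀ i ∈ P.active tau y, |P.boxProj (P.fwd tau y) i - y i| ≤ ρ) :
    c * ‖d‖ ≤ n * ((1 + L) * ρ) := by
  rcases (norm_nonneg d).eq_or_lt with h0 | h0
  · rw [← h0, mul_zero]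
    positivity
  refine le_of_mul_le_mul_right ?_ h0
  calc c * ‖d‖ * ‖d‖ = c * ‖d‖ ^ 2 := by ring
    _ ≤ inner ℝ (hess P.f y d) d := hH d
    _ = ∑ i, hess P.f y d i * d i := inner_eq_sum _ _
    _ ≤ Finset.card (Finset.univ : Finset (Fin n)) • ((1 + L) * ρ * ‖d‖) := by
      refine Finset.sum_le_card_nsmul _ _ _ fun i _ => ?_
      have hdi := abs_coord_le_norm d i
      have hHd : |hess P.f y d i| ≤ L * ‖d‖ := (abs_coord_le_norm _ i).trans
        ((ContinuousLinearMap.le_opNorm _ d).trans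
          (mul_le_mul_of_nonneg_right hHL (norm_nonneg d)))
      refine (le_abs_self _).trans ?_
      rw [abs_mul]
      by_cases h1 : i ∈ P.inactive tau y
      · rw [hd.1 i h1, abs_neg]
        calc |gradient P.f y i| * |d i| ≤ ρ * ‖d‖ := mul_le_mul (hΘ i h1) hdi (abs_nonneg _) hρ0
          _ ≤ (1 + L) * ρ * ‖d‖ := by
            refine mul_le_mul_of_nonneg_right ?_ h0.le
            linarith [mul_nonneg hL hρ0]
      by_cases h2 : i ∈ P.active tau y
      · rw [hd.2.1 i h2]
        calc |hess P.f y d i| * |P.boxProj (P.fwd tau y) i - y i| ≤ L * ‖d‖ * ρ :=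
              mul_le_mul hHd (hΓ i h2) (abs_nonneg _) (by positivity)
          _ ≤ (1 + L) * ρ * ‖d‖ := by
            linarith [mul_nonneg hρ0 h0.le]
      · have h3 : i ∉ P.idx tau y := by
          rw [mem_idx]
          tauto
        rw [hd.2.2 i h3, hy i h3, neg_zero, abs_zero, mul_zero]
        positivity
    _ = n * ((1 + L) * ρ) * ‖d‖ := by
      rw [Finset.card_univ, Fintype.card_fin, nsmul_eq_mul]
      ring

/-- `⟨∇f(y), d⟩` for a Newton direction at a point vanishing off the index set. -/
theorem IsNewtonDirection.inner_gradient_eq {tau : ℝ} {y d : Vec n}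
    (hd : P.IsNewtonDirection tau y d) (hy : ∀ i ∉ P.idx tau y, y i = 0) :
    inner ℝ (gradient P.f y) d = -inner ℝ (hess P.f y d) d +
      ∑ i ∈ P.active tau y, (hess P.f y d i + gradient P.f y i) * d i := by
  rw [← sub_eq_iff_eq_add', sub_neg_eq_add, ← inner_add_left, inner_eq_sum,
    sum_eq_add_add (P := P) tau y]
  have h1 : ∑ i ∈ P.inactive tau y, (gradient P.f y + hess P.f y d) i * d i = 0 :=
    Finset.sum_eq_zero fun i hi => by
      rw [PiLp.add_apply, hd.1 i hi, add_neg_cancel, zero_mul]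
  have h2 : ∑ i ∈ (P.idx tau y)ᶜ, (gradient P.f y + hess P.f y d) i * d i = 0 :=
    Finset.sum_eq_zero fun i hi => by
      rw [hd.2.2 i (Finset.mem_compl.1 hi), hy i (Finset.mem_compl.1 hi), neg_zero, mul_zero]
  rw [h1, h2, zero_add, add_zero]
  exact Finset.sum_congr rfl fun i _ => by rw [PiLp.add_apply, add_comm]

/-- Near a strictly complementary stationary point, the inactive and the active set are those of
the bounds. -/
theorem IsStationary.eventually_mem_active_iff (h : P.StepBounds par L α) (hf : ContDiff ℝ 2 P.f)
    {J : Finset (Fin n)} {a : Vec n} (ha : P.IsStationary par.tau J a)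
    (hSC : P.StrictComplementarity J a) :
    ∀ᶠ y in 𝓝 a, ∀ i ∈ J, (a i = P.u i → P.u i ≤ P.fwd par.tau y i) ∧
      (a i = -P.l i → P.fwd par.tau y i ≤ -P.l i) ∧
      (a i ≠ P.u i → a i ≠ -P.l i → -P.l i < P.fwd par.tau y i ∧ P.fwd par.tau y i < P.u i) := by
  refine (Finset.eventually_all J).2 fun i hi => ?_
  have hz := (continuous_fwd_apply hf par.tau i).continuousAt (x := a)
  have hτ := h.tau_pos
  have hs := ha.gradient_sign h hSC hi
  have hbox := ha.mem_box h i
  by_cases h1 : a i = P.u i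
  · have h2 : P.u i < P.fwd par.tau a i := by
      rw [fwd_apply]
      linarith [mul_pos hτ (neg_pos.2 (hs.1 h1))]
    filter_upwards [hz.eventually (lt_mem_nhds h2)] with y hy
    exact ⟨fun _ => hy.le, fun h3 => absurd (h1.symm.trans h3) (h.neg_l_lt_u i).ne',
      fun h3 => absurd h1 h3⟩
  by_cases h2 : a i = -P.l i
  · have h3 : P.fwd par.tau a i < -P.l i := by
      rw [fwd_apply]
      linarith [mul_pos hτ (hs.2 h2)]
    filter_upwards [hz.eventually (gt_mem_nhds h3)] with y hy
    exact ⟨fun h4 => absurd h4 h1, fun _ => hy.le, fun _ h4 => absurd h2 h4⟩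
  · have h0 : gradient P.f a i = 0 := by
      rcases ha.cases h hi with h3 | h3 | h3
      · exact absurd h3.1 h1
      · exact absurd h3.1 h2
      · exact h3
    have hza : P.fwd par.tau a i = a i := by rw [fwd_apply, h0, mul_zero, sub_zero]
    have h3 : -P.l i < P.fwd par.tau a i := by
      rw [hza]
      exact lt_of_le_of_ne hbox.1 (Ne.symm h2)
    have h4 : P.fwd par.tau a i < P.u i := by
      rw [hza]
      exact lt_of_le_of_ne hbox.2 h1
    filter_upwards [hz.eventually (lt_mem_nhds h3), hz.eventually (gt_mem_nhds h4)] with y h5 h6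
    exact ⟨fun h7 => absurd h7 h1, fun h7 => absurd h7 h2, fun _ _ => ⟨h5, h6⟩⟩

/-- The points of the box with index set `J` that vanish off `J`. -/
def IsIdentified (P : Problem n) (tau : ℝ) (J : Finset (Fin n)) (y : Vec n) : Prop :=
  y ∈ P.box ∧ P.idx tau y = J ∧ ∀ i ∉ J, y i = 0

/-- The projected forward step on `Γ` already equals the limit, so a full Newton step makes these
coordinates exact. -/
theorem IsStationary.eventually_active (h : P.StepBounds par L α) (hf : ContDiff ℝ 2 P.f)
    {J : Finset (Fin n)} {a : Vec n} (ha : P.IsStationary par.tau J a)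
    (hSC : P.StrictComplementarity J a) :
    ∀ᶠ y in 𝓝 a, P.IsIdentified par.tau J y →
      (∀ i ∈ P.inactive par.tau y, i ∈ J ∧ a i ≠ P.u i ∧ a i ≠ -P.l i) ∧
      (∀ i ∈ P.active par.tau y, i ∈ J ∧
        P.boxProj (P.fwd par.tau y) i = a i ∧ (a i = P.u i ∨ a i = -P.l i)) := by
  filter_upwards [ha.eventually_mem_active_iff h hf hSC] with y hy hyJ
  have hlu := h.neg_l_lt_u
  refine ⟨fun i hi => ?_, fun i hi => ?_⟩
  · have hiJ : i ∈ J := hyJ.2.1 ▸ mem_idx.2 (Or.inl hi)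
    have hyi := hy i hiJ
    rw [mem_inactive] at hi
    exact ⟨hiJ, fun h1 => (hyi.1 h1).not_gt hi.2.1, fun h1 => (hyi.2.1 h1).not_gt hi.1⟩
  · have hiJ : i ∈ J := hyJ.2.1 ▸ mem_idx.2 (Or.inr hi)
    have hyi := hy i hiJ
    rw [mem_active] at hi
    refine ⟨hiJ, ?_⟩
    by_cases h1 : a i = P.u i
    · exact ⟨by rw [h.boxProj_eq_u (hyi.1 h1), h1], Or.inl h1⟩
    by_cases h2 : a i = -P.l i
    · exact ⟨by rw [h.boxProj_eq_neg_l (hyi.2.1 h2), h2], Or.inr h2⟩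
    · have h3 := hyi.2.2 h1 h2
      rcases hi with hi | hi
      · exact absurd h3.2 hi.not_gt
      · exact absurd h3.1 hi.not_gt

theorem IsStationary.gradient_eq_zero (h : P.StepBounds par L α) {J : Finset (Fin n)} {a : Vec n}
    (ha : P.IsStationary par.tau J a) {i : Fin n} (hi : i ∈ J) (h1 : a i ≠ P.u i)
    (h2 : a i ≠ -P.l i) : gradient P.f a i = 0 := by
  rcases ha.cases h hi with h3 | h3 | h3
  · exact absurd h3.1 h1
  · exact absurd h3.1 h2
  · exact h3

theorem eventually_le_inner_hess (hf : ContDiff ℝ 2 P.f) {c : ℝ} {a : Vec n}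
    (hc : LocallyStronglyConvex P.f c a) :
    ∀ᶠ y in 𝓝 a, ∀ v, c * ‖v‖ ^ 2 ≤ inner ℝ (hess P.f y v) v := by
  obtain ⟨r, hr, hc⟩ := hc
  filter_upwards [Metric.ball_mem_nhds a hr] with y hy v
  exact le_inner_hess hf hc hy v

/-- Newton directions near a stationary point are short. -/
theorem IsStationary.eventually_norm_lt (h : P.StepBounds par L α) (hf : ContDiff ℝ 2 P.f)
    {J : Finset (Fin n)} {a : Vec n} (ha : P.IsStationary par.tau J a)
    (hSC : P.StrictComplementarity J a) {c : ℝ} (hc0 : 0 < c)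
    (hc : LocallyStronglyConvex P.f c a) {ε : ℝ} (hε : 0 < ε) :
    ∀ᶠ y in 𝓝 a, P.IsIdentified par.tau J y → ∀ d, P.IsNewtonDirection par.tau y d →
      ‖d‖ < ε := by
  have hL := h.L_pos
  -- `n + 1` in place of `n` turns the length bound into a strict one.
  set ρ := c * ε / ((n + 1) * (1 + L)) with hρdef
  have hρ : 0 < ρ := by positivity
  have hgrad : ∀ᶠ y in 𝓝 a, ∀ i : Fin n, |gradient P.f y i - gradient P.f a i| < ρ := by
    refine eventually_all.2 fun i => ?_
    have hcont : Continuous fun y => |gradient P.f y i - gradient P.f a i| := by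
      have := continuous_gradient hf
      fun_prop
    exact hcont.continuousAt.eventually (gt_mem_nhds (by simpa using hρ))
  have hcoord : ∀ᶠ y in 𝓝 a, ∀ i : Fin n, |a i - y i| < ρ := by
    refine eventually_all.2 fun i => ?_
    have hcont : Continuous fun y : Vec n => |a i - y i| := by fun_prop
    exact hcont.continuousAt.eventually (gt_mem_nhds (by simpa using hρ))
  filter_upwards [hgrad, hcoord, eventually_le_inner_hess hf hc, ha.eventually_active h hf hSC]
    with y h1 h2 h3 h4 hy d hd
  obtain ⟨h5, h6⟩ := h4 hy
  have hle := hd.norm_mul_le hL.le h3 (h.hess_le y hy.1) hρ.le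
    (fun i hi => hy.2.2 i (hy.2.1 ▸ hi))
    (fun i hi => by
      have h7 := h1 i
      obtain ⟨hiJ, h8, h9⟩ := h5 i hi
      rw [ha.gradient_eq_zero h hiJ h8 h9, sub_zero] at h7
      exact h7.le)
    (fun i hi => by
      rw [(h6 i hi).2.1]
      exact (h2 i).le)
  have hlt : n * ((1 + L) * ρ) < c * ε := by
    have h7 : (n + 1) * ((1 + L) * ρ) = c * ε := by
      rw [hρdef]
      field_simp
    have h8 : 0 < (1 + L) * ρ := by positivity
    linarith
  exact lt_of_mul_lt_mul_left (hle.trans_lt hlt) hc0.le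

/-- Properties that hold near `(a, 0)` hold for the Newton directions near `a`. -/
theorem IsStationary.eventually_newtonDirection (h : P.StepBounds par L α)
    (hf : ContDiff ℝ 2 P.f) {J : Finset (Fin n)} {a : Vec n} (ha : P.IsStationary par.tau J a)
    (hSC : P.StrictComplementarity J a) {c : ℝ} (hc0 : 0 < c)
    (hc : LocallyStronglyConvex P.f c a) {Q : Vec n × Vec n → Prop}
    (hQ : ∀ᶠ p in 𝓝 (a, (0 : Vec n)), Q p) :
    ∀ᶠ y in 𝓝 a, P.IsIdentified par.tau J y → ∀ d, P.IsNewtonDirection par.tau y d →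
      Q (y, d) := by
  obtain ⟨ε, hε, hball⟩ := Metric.eventually_nhds_iff.1 hQ
  filter_upwards [Metric.ball_mem_nhds a hε, ha.eventually_norm_lt h hf hSC hc0 hc hε]
    with y h1 h2 hy d hd
  refine hball ?_
  rw [Prod.dist_eq, dist_zero_right]
  exact max_lt h1 (h2 hy d hd)

theorem eventually_taylor_two_le (hf : ContDiff ℝ 2 P.f) (a : Vec n) {ε : ℝ} (hε : 0 < ε) :
    ∀ᶠ p in 𝓝 (a, (0 : Vec n)), P.f (p.1 + p.2) ≤ P.f p.1 + inner ℝ (gradient P.f p.1) p.2 +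
      1 / 2 * inner ℝ (hess P.f p.1 p.2) p.2 + ε * ‖p.2‖ ^ 2 := by
  obtain ⟨r, hr, hH⟩ := Metric.continuous_iff.1 (continuous_hess hf) a (ε / 2) (half_pos hε)
  have h1 : ∀ᶠ p : Vec n × Vec n in 𝓝 (a, (0 : Vec n)), p.1 ∈ Metric.ball a r :=
    continuousAt_fst.eventually (Metric.ball_mem_nhds a hr)
  have h2 : ∀ᶠ p : Vec n × Vec n in 𝓝 (a, (0 : Vec n)), p.1 + p.2 ∈ Metric.ball a r :=
    ((continuous_fst.add continuous_snd).tendsto' (a, (0 : Vec n)) a (by simp)).eventually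
      (Metric.ball_mem_nhds a hr)
  filter_upwards [h1, h2] with p hp1 hp2
  refine taylor_two_le hf (fun y hy => ?_) hp1 hp2
  rw [← dist_eq_norm]
  linarith [dist_triangle_right (hess P.f y) (hess P.f p.1) (hess P.f a), hH y hy, hH p.1 hp1]

/-- Near a strictly complementary, strongly convex stationary point the Newton system is solvable,
its solutions pass the test, and the unit step satisfies the Armijo inequality. -/
theorem IsStationary.eventually_newtonTest (h : P.StepBounds par L α) (hf : ContDiff ℝ 2 P.f)
    {J : Finset (Fin n)} {a : Vec n} (ha : P.IsStationary par.tau J a)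
    (hSC : P.StrictComplementarity J a) {c : ℝ} (hc0 : 0 < c) (hδ : par.delta ≤ c)
    (hc : LocallyStronglyConvex P.f c a) :
    ∀ᶠ y in 𝓝 a, P.IsIdentified par.tau J y → (∃ d, P.IsNewtonDirection par.tau y d) ∧
      ∀ d, P.IsNewtonDirection par.tau y d → P.NewtonTest par J y d ∧ P.Armijo par y d 0 := by
  have hσ := h.sigma_lt
  -- The Taylor error that the unit Armijo step tolerates: it is balanced by `(1/2 - σ) ⟨Hd, d⟩`.
  have hε : 0 < (1 / 2 - par.sigma) * c := mul_pos (by linarith) hc0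
  have hQ : ∀ᶠ p in 𝓝 (a, (0 : Vec n)), ∀ i ∈ J,
      (a i = P.u i → hess P.f p.1 p.2 i + gradient P.f p.1 i < 0) ∧
      (a i = -P.l i → 0 < hess P.f p.1 p.2 i + gradient P.f p.1 i) ∧
      (a i ≠ P.u i → a i ≠ -P.l i → -P.l i < p.1 i + p.2 i ∧ p.1 i + p.2 i < P.u i) := by
    refine (Finset.eventually_all J).2 fun i hi => ?_
    have hs := ha.gradient_sign h hSC hi
    have hbox := ha.mem_box h i
    have hcont : Continuous fun p : Vec n × Vec n => hess P.f p.1 p.2 i + gradient P.f p.1 i := by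
      have h1 := continuous_gradient hf
      have h2 := continuous_hess hf
      have h3 : Continuous fun p : Vec n × Vec n => hess P.f p.1 p.2 :=
        (h2.comp continuous_fst).clm_apply continuous_snd
      fun_prop
    have hcont2 : Continuous fun p : Vec n × Vec n => p.1 i + p.2 i := by fun_prop
    refine .and ?_ (.and ?_ ?_)
    · by_cases h1 : a i = P.u i
      · filter_upwards [hcont.continuousAt.eventually (gt_mem_nhds
          (by simpa using hs.1 h1 : hess P.f a 0 i + gradient P.f a i < 0))] with p hp _
        exact hp
      · exact Eventually.of_forall fun p h2 => absurd h2 h1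
    · by_cases h1 : a i = -P.l i
      · filter_upwards [hcont.continuousAt.eventually (lt_mem_nhds
          (by simpa using hs.2 h1 : 0 < hess P.f a 0 i + gradient P.f a i))] with p hp _
        exact hp
      · exact Eventually.of_forall fun p h2 => absurd h2 h1
    · by_cases h1 : a i = P.u i
      · exact Eventually.of_forall fun p h2 => absurd h1 h2
      by_cases h2 : a i = -P.l i
      · exact Eventually.of_forall fun p _ h3 => absurd h2 h3
      have h3 : -P.l i < a i + (0 : Vec n) i := by
        simpa using lt_of_le_of_ne hbox.1 (Ne.symm h2)
      have h4 : a i + (0 : Vec n) i < P.u i := by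
        simpa using lt_of_le_of_ne hbox.2 h1
      filter_upwards [hcont2.continuousAt.eventually (lt_mem_nhds h3),
        hcont2.continuousAt.eventually (gt_mem_nhds h4)] with p h5 h6 _ _
      exact ⟨h5, h6⟩
  have hsupp : ∀ᶠ y in 𝓝 a, ∀ i ∈ J, y i ≠ 0 :=
    (Finset.eventually_all J).2 fun i hi =>
      (by fun_prop : Continuous fun y : Vec n => y i).continuousAt.eventually_ne (ha.ne_zero h hi)
  filter_upwards [ha.eventually_newtonDirection h hf hSC hc0 hc hQ,
    ha.eventually_newtonDirection h hf hSC hc0 hc (eventually_taylor_two_le hf a hε),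
    eventually_le_inner_hess hf hc, ha.eventually_active h hf hSC, hsupp]
    with y hyQ hyT hH hact hys hy
  refine ⟨exists_isNewtonDirection hc0 hH, fun d hd => ?_⟩
  obtain ⟨hΘ, hΓ⟩ := hact hy
  have hq := hyQ hy d hd
  have hT := hyT hy d hd
  have hbox := hy.1
  have hy0 : ∀ i ∉ P.idx par.tau y, y i = 0 := fun i hi => hy.2.2 i (hy.2.1 ▸ hi)
  have hin := hd.inner_gradient_eq hy0
  -- `d i = a i - y i` points to the active bound, while `Hd + g` keeps the strict sign of the
  -- gradient at `a`.
  have hneg : ∑ i ∈ P.active par.tau y, (hess P.f y d i + gradient P.f y i) * d i ≤ 0 := by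
    refine Finset.sum_nonpos fun i hi => ?_
    obtain ⟨hiJ, hp, hb⟩ := hΓ i hi
    rw [hd.2.1 i hi, hp]
    have hyi := hbox i
    rcases hb with hb | hb
    · exact mul_nonpos_of_nonpos_of_nonneg ((hq i hiJ).1 hb).le (by linarith)
    · exact mul_nonpos_of_nonneg_of_nonpos ((hq i hiJ).2.1 hb).le (by linarith)
  have hHd := hH d
  refine ⟨⟨?_, ?_, fun i => ?_, Or.inr hy.2.1⟩, ?_⟩
  · have h1 : ∑ i ∈ P.idx par.tau y, gradient P.f y i * d i = inner ℝ (gradient P.f y) d := by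
      rw [inner_eq_sum]
      refine Finset.sum_subset (Finset.subset_univ _) fun i _ hi => ?_
      rw [hd.2.2 i hi, hy0 i hi, neg_zero, mul_zero]
    have h2 : ∑ i ∈ (P.idx par.tau y)ᶜ, y i ^ 2 = 0 := Finset.sum_eq_zero fun i hi => by
      rw [hy0 i (Finset.mem_compl.1 hi), zero_pow two_ne_zero]
    rw [h1, h2, zero_div, add_zero, hin]
    have h3 := mul_le_mul_of_nonneg_right hδ (sq_nonneg ‖d‖)
    linarith
  · exact Finset.card_le_card fun i hi => mem_supp.2 (hys i (hy.2.1 ▸ hi))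
  · rw [PiLp.add_apply]
    by_cases h1 : i ∈ P.inactive par.tau y
    · obtain ⟨hiJ, h2, h3⟩ := hΘ i h1
      have h4 := (hq i hiJ).2.2 h2 h3
      exact ⟨h4.1.le, h4.2.le⟩
    by_cases h2 : i ∈ P.active par.tau y
    · rw [hd.2.1 i h2, (hΓ i h2).2.1, add_sub_cancel]
      exact ha.mem_box h i
    · have h3 : i ∉ P.idx par.tau y := by
        rw [mem_idx]
        tauto
      rw [hd.2.2 i h3, add_neg_cancel]
      exact h.zero_mem_box i
  · rw [Armijo, pow_zero, hd.newtonPoint_one, mul_one]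
    rw [hin] at hT ⊢
    have h1 := mul_le_mul_of_nonneg_left hHd (by linarith : 0 ≤ 1 / 2 - par.sigma)
    have h2 := mul_nonpos_of_nonneg_of_nonpos (by linarith : 0 ≤ 1 - par.sigma) hneg
    linarith

/-- Full Newton steps contract quadratically if the Hessian is Lipschitz. -/
theorem IsStationary.eventually_norm_add_sub_le (h : P.StepBounds par L α)
    (hf : ContDiff ℝ 2 P.f) {J : Finset (Fin n)} {a : Vec n} (ha : P.IsStationary par.tau J a)
    (hSC : P.StrictComplementarity J a) {c M : ℝ}
    (hc : LocallyStronglyConvex P.f c a) (hM : HessianLocallyLipschitz P.f M a) :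
    ∀ᶠ y in 𝓝 a, P.IsIdentified par.tau J y → ∀ d, P.IsNewtonDirection par.tau y d →
      c * ‖y + d - a‖ ≤ M / 2 * ‖y - a‖ ^ 2 := by
  obtain ⟨r, hr, hM⟩ := hM
  filter_upwards [Metric.ball_mem_nhds a hr, eventually_le_inner_hess hf hc,
    ha.eventually_active h hf hSC] with y hyr hH hact hy d hd
  obtain ⟨hΘ, hΓ⟩ := hact hy
  have hT := norm_gradient_taylor_le hf hM hyr (Metric.mem_ball_self hr)
  rw [norm_sub_rev a y] at hT
  set e := y + d - a with he
  set w := gradient P.f a - gradient P.f y - hess P.f y (a - y)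
  -- The error after a full step lives on `Θ` only, where the Newton rows and `∇f(a) = 0` identify
  -- `He` with the Taylor remainder `w`.
  have he0 : ∀ i ∉ P.inactive par.tau y, e i = 0 := fun i hi => by
    rw [he, PiLp.sub_apply, PiLp.add_apply]
    by_cases h2 : i ∈ P.active par.tau y
    · rw [hd.2.1 i h2, (hΓ i h2).2.1]
      ring
    · have h3 : i ∉ P.idx par.tau y := by
        rw [mem_idx]
        tauto
      rw [hd.2.2 i h3, ha.eq_zero i (hy.2.1 ▸ h3)]
      ring
  have hin : inner ℝ (hess P.f y e) e = inner ℝ w e := by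
    rw [inner_eq_sum, inner_eq_sum]
    refine Finset.sum_congr rfl fun i _ => ?_
    by_cases hi : i ∈ P.inactive par.tau y
    · obtain ⟨hiJ, h2, h3⟩ := hΘ i hi
      have h4 : hess P.f y e i = hess P.f y d i - hess P.f y (a - y) i := by
        have h5 : e = d - (a - y) := by
          rw [he]
          abel
        rw [h5, map_sub, PiLp.sub_apply]
      have h6 : w i = gradient P.f a i - gradient P.f y i - hess P.f y (a - y) i := rfl
      rw [h4, hd.1 i hi, h6, ha.gradient_eq_zero h hiJ h2 h3, zero_sub]
    · rw [he0 i hi, mul_zero, mul_zero]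
  rcases (norm_nonneg e).eq_or_lt with h0 | h0
  · rw [← h0, mul_zero]
    exact (norm_nonneg _).trans hT
  refine le_of_mul_le_mul_right ?_ h0
  calc c * ‖e‖ * ‖e‖ = c * ‖e‖ ^ 2 := by ring
    _ ≤ inner ℝ (hess P.f y e) e := hH e
    _ = inner ℝ w e := hin
    _ ≤ ‖w‖ * ‖e‖ := real_inner_le_norm _ _
    _ ≤ M / 2 * ‖y - a‖ ^ 2 * ‖e‖ := mul_le_mul_of_nonneg_right hT h0.le

theorem NewtonStep.eq_add {x d y : Vec n} {J : Finset (Fin n)}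
    (hs : P.NewtonStep par J x d y) (hA : P.Armijo par x d 0) : y = x + d := by
  obtain ⟨hd, -, m, hm, rfl⟩ := hs
  rw [Nat.le_zero.1 (hm.2 hA), pow_zero, hd.newtonPoint_one]

end Problem

end BNL0R

/-! ### Assembly of the global and local convergence statements -/

theorem mainTheorem1 (n : ℕ) (P : BNL0R.Problem n) (par : BNL0R.Params)
    (L ell : ℝ) (x d : ℕ → BNL0R.Vec n) (xstar : BNL0R.Vec n)
    -- the problem
    (hf : ContDiff ℝ 2 P.f) (hbdd : BddBelow (Set.range P.f))
    (hl : ∀ i, 0 ≤ P.l i) (hu : ∀ i, 0 ≤ P.u i)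
    (hlam : 0 < P.lam) (hgrad0 : gradient P.f 0 ≠ 0) (hlamUpper : P.lam < P.lamUpper par.tau)
    -- smoothness and local strong convexity
    (hL : 0 < L) (hsmooth : BNL0R.StronglySmooth P.f L)
    (hhess : ∀ y ∈ P.box, ‖BNL0R.hess P.f y‖ ≤ L)
    (hell : 0 < ell) (hconv : BNL0R.LocallyStronglyConvex P.f ell xstar)
    -- the parameters of the algorithm
    (hsigma : par.sigma ∈ Set.Ioo (0 : ℝ) (1 / 2)) (hbeta : par.beta ∈ Set.Ioo (0 : ℝ) 1)
    (hdelta : par.delta ∈ Set.Ioo (0 : ℝ) (min 1 ell))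
    (htau : par.tau ∈ Set.Ioo (0 : ℝ) (P.tauBar par L))
    -- the iterates and the accumulation point
    (hrun : P.IsRun par x d) (hacc : MapClusterPt xstar Filter.atTop x)
    -- constraint qualifications at `xstar` for the eventually constant index set
    (hSC : ∀ J : Finset (Fin n), (∀ᶠ k in Filter.atTop, P.idx par.tau (x k) = J) →
      P.StrictComplementarity J xstar)
    (hCQ : ∀ J : Finset (Fin n), (∀ᶠ k in Filter.atTop, P.idx par.tau (x k) = J) →
      P.AbadieCQ J xstar) :
    (Filter.Tendsto x Filter.atTop (nhds xstar) ∧ P.IsStrictLocalMin xstar) ∧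
    (∃ K : ℕ, ∀ k ≥ K,
      P.NewtonStep par (P.prevIdx par.tau x k) (x k) (d k) (x (k + 1))) ∧
    (∀ M : ℝ, 0 ≤ M → BNL0R.HessianLocallyLipschitz P.f M xstar →
      ∃ K : ℕ, ∀ k ≥ K,
        ‖x (k + 1) - xstar‖ ≤ M / (2 * min 1 ell) * ‖x k - xstar‖ ^ 2) := by
  have h := BNL0R.Problem.stepBounds_of_lt_tauBar hl hu hlam hL hsmooth hhess hsigma hbeta
    hdelta.1 htau
  obtain ⟨J, hJ⟩ := hrun.exists_idx_eventually_eq h hbdd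
  have ha := hrun.isStationary h hf hbdd hacc hJ
  have hlim := hrun.tendsto h hf hbdd hell hconv hacc
  have hδ : par.delta ≤ ell := hdelta.2.le.trans (min_le_right _ _)
  have hid : ∀ᶠ k in atTop, P.IsIdentified par.tau J (x k) := by
    filter_upwards [hJ, hrun.eventually_apply_eq_zero hJ] with k h1 h2
    exact ⟨hrun.mem_box h k, h1, h2⟩
  have hprev : ∀ᶠ k in atTop, P.prevIdx par.tau x k = J := by
    rw [← map_add_atTop_eq_nat 1, eventually_map]
    exact hJ
  have hnewton : ∀ᶠ k in atTop,
      P.NewtonStep par (P.prevIdx par.tau x k) (x k) (d k) (x (k + 1)) ∧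
        P.Armijo par (x k) (d k) 0 := by
    filter_upwards [hid, hprev,
      hlim.eventually (ha.eventually_newtonTest h hf (hSC J hJ) hell hδ hconv)] with k h1 h2 h3
    obtain ⟨h4, h5⟩ := h3 h1
    -- A gradient step would need an unsolvable system or a solution failing the test; both are now
    -- excluded.
    rcases hrun.step k with hs | ⟨h6 | ⟨d', h6, h7⟩, -⟩
    · exact ⟨hs, (h5 _ hs.1).2⟩
    · exact absurd h4 h6
    · exact absurd (h2 ▸ (h5 d' h6).1) h7
  refine ⟨⟨hlim, ha.isStrictLocalMin h hf hell hconv⟩,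
    eventually_atTop.1 (hnewton.mono fun k hk => hk.1), fun M _ hM => eventually_atTop.1 ?_⟩
  filter_upwards [hnewton, hid,
    hlim.eventually (ha.eventually_norm_add_sub_le h hf (hSC J hJ) hconv hM)] with k h1 h2 h3
  have h4 := h3 h2 (d k) h1.1.1
  rw [h1.1.eq_add h1.2]
  have hmin : 0 < min 1 ell := lt_min one_pos hell
  have h5 := mul_le_mul_of_nonneg_right (min_le_right 1 ell) (norm_nonneg (x k + d k - xstar))
  rw [div_mul_eq_mul_div, le_div_iff₀ (by linarith)]
  linarith
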